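/- Let $n\ge 2$ and let $d$ be a generic metric on $\{1,\dots,n\}$: a symmetric, nonnegative real matrix $d=(d(i,j))$, not identically zero, with zero diagonal and $d(i,k)\le d(i,j)+d(j,k)$ for all $i,j,k$, such that the polyhedron \[ P_d=\{x\in\mathbb R^n : x_i+x_j\ge d(i,j)\text{ for all } i,j \text{ (including } i=j)\} \] is simple, i.e. every vertex of $P_d$ lies in exactly $n$ facets of $P_d$. Let $T_d$ (the tight span of $d$) be the complex of nonempty bounded faces of $P_d$, and let $\Delta_{n,2}=\operatorname{conv}\{e_i+e_j : 1\le i<j\le n\}$ be the second hypersimplex. Let $\Delta^d$ be the regular subdivision of $\Delta_{n,2}$ whose nonempty cells are the polytopes $\operatorname{conv}\{e_i+e_j : \{i,j\}\in E(\Gamma)\}$, where $\Gamma$ runs over the graphs on $\{1,\dots,n\}$ with at least one edge for which there is $\lambda\in\mathbb R^n$ with $\lambda_i+\lambda_j=d(i,j)$ for every edge $\{i,j\}$ of $\Gamma$ and $\lambda_i+\lambda_j>d(i,j)$ for every pair $i\ne j$ that is not an edge of $\Gamma$. A cell is called interior if it is not contained in the relative boundary of $\Delta_{n,2}$. Write $f_k(T_d)$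 for the number of $k$-dimensional faces of $T_d$ and $f_k(\operatorname{int}\Delta^d)$ for the number of $k$-dimensional interior cells of $\Delta^d$. Then $\Delta^d$ is a triangulation of $\Delta_{n,2}$ and it is almost small-face-free: it has no interior face of dimension less than $\lfloor (n-1)/2\rfloor$. Moreover, if $n\ne 3$, then \[ f_{\lfloor n/2\rfloor}(T_d)=f_{\lceil n/2\rceil-1}(\operatorname{int}\Delta^d), \] and for every $n\ge 2$ each of the numbers $f_{\lfloor n/2\rfloor}(T_d)$ and $f_{\lceil n/2\rceil-1}(\operatorname{int}\Delta^d)$ is at most $1$ if $n$ is even and at most $n$ if $n$ is odd. -/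

import Mathlib

/-! ### Faces of convex sets -/

/-- `F` is a nonempty face of `P`: the set of maximizers over `P` of some linear functional
(the functional `0` gives `P` itself). -/
def IsNonemptyFace {n : ℕ} (P F : Set (Fin n → ℝ)) : Prop :=
  IsExposed ℝ P F ∧ F.Nonempty

/-- The dimension of a set, that is, of its affine hull. -/
noncomputable def affDim {n : ℕ} (F : Set (Fin n → ℝ)) : ℕ :=
  Module.finrank ℝ (vectorSpan ℝ F)

/-- A facet of `P` is a face of dimension `dim P - 1`. -/
def IsFacet {n : ℕ} (P F : Set (Fin n → ℝ)) : Prop :=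
  IsNonemptyFace P F ∧ affDim F + 1 = affDim P

/-- A pointed polyhedron `P` is simple if each vertex is contained in exactly `dim P` facets. -/
def IsSimplePolyhedron {n : ℕ} (P : Set (Fin n → ℝ)) : Prop :=
  ∀ v ∈ P.extremePoints ℝ, {F | IsFacet P F ∧ v ∈ F}.encard = affDim P

/-- The bounded subcomplex of `P`: its nonempty bounded faces. -/
def boundedSubcomplex {n : ℕ} (P : Set (Fin n → ℝ)) : Set (Set (Fin n → ℝ)) :=
  {F | IsNonemptyFace P F ∧ Bornology.IsBounded F}

/-- The number of `k`-dimensional members of a polyhedral complex. -/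
noncomputable def faceCount {n : ℕ} (C : Set (Set (Fin n → ℝ))) (k : ℕ) : ℕ∞ :=
  {F ∈ C | affDim F = k}.encard

/-! ### Metrics and tight spans -/

/-- A metric on `n` points: a nonnegative symmetric matrix with zero diagonal satisfying the
triangle inequality. -/
structure IsFiniteMetric {n : ℕ} (d : Fin n → Fin n → ℝ) : Prop where
  nonneg : ∀ i j, 0 ≤ d i j
  symm : ∀ i j, d i j = d j i
  diag : ∀ i, d i i = 0
  triangle : ∀ i j k, d i k ≤ d i j + d j k

/-- The polyhedron `P_d`; the case `i = j` says that the coordinates are nonnegative. -/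
def metricPolyhedron {n : ℕ} (d : Fin n → Fin n → ℝ) : Set (Fin n → ℝ) :=
  {x | ∀ i j, d i j ≤ x i + x j}

/-- The tight span `T_d`, as the complex of bounded faces of `P_d`. -/
def tightSpan {n : ℕ} (d : Fin n → Fin n → ℝ) : Set (Set (Fin n → ℝ)) :=
  boundedSubcomplex (metricPolyhedron d)

/-- `d` is generic if the polyhedron `P_d` is simple. -/
def IsGenericMetric {n : ℕ} (d : Fin n → Fin n → ℝ) : Prop :=
  IsSimplePolyhedron (metricPolyhedron d)

/-! ### The second hypersimplex and its subdivision induced by `d` -/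

/-- The points `e_i + e_j`, for the edges `{i, j}` of a graph. -/
def edgePoints {n : ℕ} (G : SimpleGraph (Fin n)) : Set (Fin n → ℝ) :=
  {x | ∃ i j, G.Adj i j ∧ x = Pi.single i 1 + Pi.single j 1}

/-- The second hypersimplex: the convex hull of all `e_i + e_j` with `i ≠ j`. -/
def secondHypersimplex (n : ℕ) : Set (Fin n → ℝ) :=
  convexHull ℝ (edgePoints (⊤ : SimpleGraph (Fin n)))

/-- The graph `G` is a cell of the subdivision: it admits a height function `lam`. -/
def IsCellGraph {n : ℕ} (d : Fin n → Fin n → ℝ) (G : SimpleGraph (Fin n)) : Prop :=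
  ∃ lam : Fin n → ℝ, ∀ i j, i ≠ j →
    (G.Adj i j → lam i + lam j = d i j) ∧ (¬ G.Adj i j → d i j < lam i + lam j)

/-- The subdivision `Δ^d` of the second hypersimplex: its nonempty cells (of all dimensions), each
given by the finite set of its vertices. -/
def hypersimplexSubdivision {n : ℕ} (d : Fin n → Fin n → ℝ) : Set (Finset (Fin n → ℝ)) :=
  {s | s.Nonempty ∧ ∃ G : SimpleGraph (Fin n), IsCellGraph d G ∧ (s : Set (Fin n → ℝ)) = edgePoints G}

/-! ### Triangulations of a polytope -/

/-- `C` is (the set of vertex sets of the simplices of) a triangulation of `Q`. -/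
def IsTriangulationOf {n : ℕ} (C : Set (Finset (Fin n → ℝ))) (Q : Set (Fin n → ℝ)) : Prop :=
  ∃ K : Geometry.SimplicialComplex ℝ (Fin n → ℝ), K.faces = C ∧ K.space = Q

/-- The interior faces of a triangulation `C` of the polytope `Q`: those simplices that do not lie
in the (relative) boundary of `Q`. -/
def interiorFaces {n : ℕ} (C : Set (Finset (Fin n → ℝ))) (Q : Set (Fin n → ℝ)) :
    Set (Finset (Fin n → ℝ)) :=
  {s ∈ C | ¬ convexHull ℝ (s : Set (Fin n → ℝ)) ⊆ intrinsicFrontier ℝ Q}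

/-- The number of `k`-dimensional simplices (`k + 1` vertices) in a collection of simplices. -/
noncomputable def simplexCount {n : ℕ} (C : Set (Finset (Fin n → ℝ))) (k : ℕ) : ℕ∞ :=
  {s ∈ C | s.card = k + 1}.encard

/-- A triangulation `C` of an `m`-dimensional polytope `Q` is almost small-face-free if it has no
very small interior face, that is, no interior face of dimension `< ⌊m / 2⌋`. -/
def IsAlmostSmallFaceFree {n : ℕ} (m : ℕ) (C : Set (Finset (Fin n → ℝ)))
    (Q : Set (Fin n → ℝ)) : Prop :=
  ∀ k < m / 2, ∀ s ∈ interiorFaces C Q, s.card ≠ k + 1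

/-! Everything is read off from sets of tight pairs. The row `d i` is a vertex of `P_d` where the
`n` pairs containing `i` are tight. Simplicity allows no further facet there, which forces positive
distances (`pos_of_isGenericMetric`) and strict triangle inequalities (`triangle_lt`). Then every
constraint defines a facet, so at a vertex the tight `edgeVec`s form a basis, and at every point of
`P_d` they are independent (`linearIndepOn_tightSet`).

A height, unlike a point of `P_d`, may have nonpositive coordinates; but if `lam i ≤ 0`, all its
tight pairs contain `i` (`mem_of_apply_nonpos`), so its cell is still independent. Hence cells are
simplices; complementary slackness makes them meet properly, and linear programming duality makes
them cover.

An interior cell is an edge cover, as is the tight set of a bounded face of `P_d`. A cell of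
dimension `⌈n/2⌉ - 1` has `⌈n/2⌉` edges, and a face of dimension `⌊n/2⌋` has `⌈n/2⌉` tight pairs, so
both counts concern edge covers of least size. The two counts agree unless such a cover can be a
star, a problem only for `n = 2` (treated by hand) and `n = 3`. A cell is determined by its degree
sequence, which here is all ones, with a single two if `n` is odd; hence the bounds `1` and `n`. -/

open Finset

variable {n : ℕ} {d : Fin n → Fin n → ℝ}

/-! ### Edge vectors and tight constraints -/

/-- The point `e_i + e_j` of a pair `{i, j}`, where `i = j` is allowed. -/
noncomputable def edgeVec (e : Sym2 (Fin n)) : Fin n → ℝ :=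
  e.lift ⟨fun i j => Pi.single i 1 + Pi.single j 1, fun _ _ => add_comm _ _⟩

/-- The linear functional `x ↦ x_i + x_j` of a pair `{i, j}`. -/
noncomputable def pairSum (e : Sym2 (Fin n)) : (Fin n → ℝ) →ₗ[ℝ] ℝ :=
  e.lift ⟨fun i j => LinearMap.proj i + LinearMap.proj j, fun _ _ => add_comm _ _⟩

/-- The right-hand side of the constraint belonging to a pair. -/
noncomputable def weight (d : Fin n → Fin n → ℝ) (e : Sym2 (Fin n)) : ℝ :=
  -- Averaging descends to unordered pairs without assuming `d` symmetric.
  e.lift ⟨fun i j => (d i j + d j i) / 2, fun i j => by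
    simp only [add_comm (d i j)]⟩

open Classical in
/-- The pairs whose constraint is tight at `x`. -/
noncomputable def tightSet (d : Fin n → Fin n → ℝ) (x : Fin n → ℝ) : Finset (Sym2 (Fin n)) :=
  {e | pairSum e x = weight d e}

open Classical in
/-- The pairs of distinct points whose constraint is tight at `x`. -/
noncomputable def cellEdges (d : Fin n → Fin n → ℝ) (x : Fin n → ℝ) : Finset (Sym2 (Fin n)) :=
  {e ∈ tightSet d x | ¬ e.IsDiag}

/-- The points of `P_d` at which all constraints in `T` are tight. -/
def tightFace (d : Fin n → Fin n → ℝ) (T : Finset (Sym2 (Fin n))) : Set (Fin n → ℝ) :=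
  {x ∈ metricPolyhedron d | ∀ e ∈ T, pairSum e x = weight d e}

@[simp] lemma edgeVec_mk (i j : Fin n) :
    edgeVec s(i, j) = Pi.single i 1 + Pi.single j 1 := rfl

@[simp] lemma pairSum_mk (i j : Fin n) (x : Fin n → ℝ) : pairSum s(i, j) x = x i + x j := rfl

lemma weight_mk (hd : IsFiniteMetric d) (i j : Fin n) : weight d s(i, j) = d i j := by
  change (d i j + d j i) / 2 = d i j
  rw [hd.symm j i]; ring

@[simp] lemma mem_tightSet {x : Fin n → ℝ} {e : Sym2 (Fin n)} :
    e ∈ tightSet d x ↔ pairSum e x = weight d e := by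
  simp [tightSet]

@[simp] lemma mem_cellEdges {x : Fin n → ℝ} {e : Sym2 (Fin n)} :
    e ∈ cellEdges d x ↔ pairSum e x = weight d e ∧ ¬ e.IsDiag := by
  simp [cellEdges]

lemma pairSum_eq_dotProduct (e : Sym2 (Fin n)) (x : Fin n → ℝ) :
    pairSum e x = edgeVec e ⬝ᵥ x := by
  induction e with | _ i j => simp [add_dotProduct]

lemma edgeVec_nonneg (e : Sym2 (Fin n)) (k : Fin n) : 0 ≤ edgeVec e k := by
  induction e with | _ i j =>
  simp only [edgeVec_mk, Pi.add_apply, Pi.single_apply]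
  split_ifs <;> norm_num

lemma edgeVec_apply_of_notMem {e : Sym2 (Fin n)} {k : Fin n} (h : k ∉ e) : edgeVec e k = 0 := by
  induction e with | _ i j =>
  simp only [Sym2.mem_iff, not_or] at h
  simp [h.1, h.2]

lemma edgeVec_apply_of_mem {e : Sym2 (Fin n)} {k : Fin n} (he : ¬ e.IsDiag) (h : k ∈ e) :
    edgeVec e k = 1 := by
  induction e with | _ i j =>
  simp only [Sym2.mem_iff, Sym2.mk_isDiag_iff] at h he
  rcases h with rfl | rfl
  · simp [he]
  · simp [Ne.symm he]

lemma sum_edgeVec (e : Sym2 (Fin n)) : ∑ k, edgeVec e k = 2 := by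
  induction e with | _ i j =>
  simp [Finset.sum_add_distrib]; norm_num

lemma edgeVec_pos_iff {e : Sym2 (Fin n)} {k : Fin n} : 0 < edgeVec e k ↔ k ∈ e := by
  constructor
  · intro h
    by_contra hk
    rw [edgeVec_apply_of_notMem hk] at h
    exact lt_irrefl _ h
  · induction e with | _ i j =>
    intro h
    simp only [Sym2.mem_iff] at h
    simp only [edgeVec_mk, Pi.add_apply, Pi.single_apply]
    rcases h with rfl | rfl <;> split_ifs <;> norm_num at *

lemma edgeVec_injective : Function.Injective (edgeVec : Sym2 (Fin n) → Fin n → ℝ) := by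
  intro e f h
  have hmem : ∀ k, k ∈ e ↔ k ∈ f := fun k => by
    rw [← edgeVec_pos_iff, ← edgeVec_pos_iff, h]
  exact Sym2.ext hmem

lemma mem_metricPolyhedron_iff (hd : IsFiniteMetric d) {x : Fin n → ℝ} :
    x ∈ metricPolyhedron d ↔ ∀ e, weight d e ≤ pairSum e x := by
  constructor
  · intro h e
    induction e with | _ i j =>
    rw [weight_mk hd, pairSum_mk]
    exact h i j
  · intro h i j
    have := h s(i, j)
    rwa [weight_mk hd, pairSum_mk] at this

lemma nonneg_of_mem_metricPolyhedron (hd : IsFiniteMetric d) {x : Fin n → ℝ}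
    (hx : x ∈ metricPolyhedron d) (i : Fin n) : 0 ≤ x i := by
  have := hx i i
  rw [hd.diag] at this
  linarith

lemma cellEdges_eq_tightSet {x : Fin n → ℝ} (h : ∀ e ∈ tightSet d x, ¬ e.IsDiag) :
    cellEdges d x = tightSet d x := by
  ext e
  simp only [mem_cellEdges, mem_tightSet, and_iff_left_iff_imp]
  intro he
  exact h e (mem_tightSet.2 he)

lemma mem_tightFace_tightSet {x : Fin n → ℝ} (hx : x ∈ metricPolyhedron d) :
    x ∈ tightFace d (tightSet d x) :=
  ⟨hx, fun _ he => mem_tightSet.1 he⟩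

/-- Strict constraints survive a small move in a fixed direction. -/
lemma exists_pos_forall_weight_lt (d : Fin n → Fin n → ℝ) (x u : Fin n → ℝ) :
    ∃ ε : ℝ, 0 < ε ∧ ∀ e, weight d e < pairSum e x → weight d e < pairSum e (x + ε • u) := by
  have h : ∀ e : Sym2 (Fin n), ∀ᶠ ε : ℝ in nhdsWithin 0 (Set.Ioi 0),
      weight d e < pairSum e x → weight d e < pairSum e (x + ε • u) := by
    intro e
    by_cases he : weight d e < pairSum e x
    · have hc : Continuous fun ε : ℝ => pairSum e x + ε * pairSum e u := by fun_prop
      have h1 : ∀ᶠ ε : ℝ in nhds 0, weight d e < pairSum e x + ε * pairSum e u :=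
        hc.continuousAt.eventually_mem (isOpen_Ioi.mem_nhds (by simpa using he))
      filter_upwards [h1.filter_mono nhdsWithin_le_nhds] with ε hε _
      simpa using hε
    · exact Filter.Eventually.of_forall fun ε h => absurd h he
  obtain ⟨ε, hε, hpos⟩ := ((Filter.eventually_all.2 h).and self_mem_nhdsWithin).exists
  exact ⟨ε, hpos, hε⟩

/-- A move that does not decrease the tight constraints stays in `P_d` for a while. -/
lemma exists_pos_add_smul_mem (hd : IsFiniteMetric d) {x u : Fin n → ℝ}
    (hx : x ∈ metricPolyhedron d) (hu : ∀ e ∈ tightSet d x, 0 ≤ pairSum e u) :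
    ∃ ε : ℝ, 0 < ε ∧ x + ε • u ∈ metricPolyhedron d := by
  obtain ⟨ε, hε, h⟩ := exists_pos_forall_weight_lt d x u
  refine ⟨ε, hε, (mem_metricPolyhedron_iff hd).2 fun e => ?_⟩
  rcases ((mem_metricPolyhedron_iff hd).1 hx e).lt_or_eq with he | he
  · exact (h e he).le
  · rw [map_add, map_smul, he, smul_eq_mul]
    have := mul_nonneg hε.le (hu e (mem_tightSet.2 he.symm))
    linarith

/-! ### Independent families of edge vectors -/

lemma mulVec_edgeVec {T : Finset (Sym2 (Fin n))} (u : Fin n → ℝ) (e : T) :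
    (Matrix.of fun e : T => edgeVec (e : Sym2 (Fin n))).mulVecLin u e = pairSum (e : Sym2 _) u := by
  rw [pairSum_eq_dotProduct]; rfl

lemma finrank_range_edgeVec {T : Finset (Sym2 (Fin n))} (hT : LinearIndepOn ℝ edgeVec (T : Set (Sym2 (Fin n)))) :
    Module.finrank ℝ (LinearMap.range
      (Matrix.of fun e : T => edgeVec (e : Sym2 (Fin n))).mulVecLin) = T.card := by
  have h := LinearIndependent.rank_matrix (M := Matrix.of fun e : T => edgeVec (e : Sym2 (Fin n)))
    (by exact hT)
  rw [Fintype.card_coe] at h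
  exact h

/-- Independent rows make the evaluation map surjective. This supplies directions that move the
tight constraints at prescribed rates. -/
lemma exists_forall_pairSum_eq {T : Finset (Sym2 (Fin n))}
    (hT : LinearIndepOn ℝ edgeVec (T : Set (Sym2 (Fin n)))) (c : Sym2 (Fin n) → ℝ) :
    ∃ u : Fin n → ℝ, ∀ e ∈ T, pairSum e u = c e := by
  have h := Submodule.eq_top_of_finrank_eq (K := ℝ) (V := T → ℝ)
    ((finrank_range_edgeVec hT).trans (by simp))
  obtain ⟨u, hu⟩ := LinearMap.range_eq_top.1 h fun e => c e
  refine ⟨u, fun e he => ?_⟩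
  rw [← congrFun hu ⟨e, he⟩, mulVec_edgeVec]

/-- A kernel direction keeps the tight constraints tight, and the slack ones tolerate a short move
along it. -/
lemma vectorSpan_tightFace (hd : IsFiniteMetric d) {x : Fin n → ℝ} (hx : x ∈ metricPolyhedron d) :
    vectorSpan ℝ (tightFace d (tightSet d x)) = LinearMap.ker
      (Matrix.of fun e : tightSet d x => edgeVec (e : Sym2 (Fin n))).mulVecLin := by
  have hker : ∀ u, u ∈ LinearMap.ker
      (Matrix.of fun e : tightSet d x => edgeVec (e : Sym2 (Fin n))).mulVecLin ↔
      ∀ e ∈ tightSet d x, pairSum e u = 0 := by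
    intro u
    rw [LinearMap.mem_ker, funext_iff]
    simp only [mulVec_edgeVec, Pi.zero_apply, Subtype.forall]
  apply le_antisymm
  · rw [vectorSpan, Submodule.span_le]
    rintro _ ⟨y, hy, z, hz, rfl⟩
    rw [SetLike.mem_coe, hker]
    intro e he
    change pairSum e (y - z) = 0
    rw [map_sub, hy.2 e he, hz.2 e he, sub_self]
  · intro u hu
    rw [hker] at hu
    obtain ⟨ε, hε, h⟩ := exists_pos_add_smul_mem hd hx (u := u) fun e he => (hu e he).ge
    have hmem : x + ε • u ∈ tightFace d (tightSet d x) :=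
      ⟨h, fun e he => by simp [hu e he, mem_tightSet.1 he]⟩
    have := vsub_mem_vectorSpan ℝ hmem (mem_tightFace_tightSet hx)
    rw [vsub_eq_sub, add_sub_cancel_left] at this
    exact (Submodule.smul_mem_iff _ hε.ne').1 this

lemma affDim_tightFace (hd : IsFiniteMetric d) {x : Fin n → ℝ} (hx : x ∈ metricPolyhedron d)
    (hT : LinearIndepOn ℝ edgeVec (tightSet d x : Set (Sym2 (Fin n)))) :
    affDim (tightFace d (tightSet d x)) + (tightSet d x).card = n := by
  rw [affDim, vectorSpan_tightFace hd hx, ← finrank_range_edgeVec hT, add_comm,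
    LinearMap.finrank_range_add_finrank_ker]
  simp

lemma isNonemptyFace_tightFace (hd : IsFiniteMetric d) {x : Fin n → ℝ}
    {T : Finset (Sym2 (Fin n))} (hx : x ∈ tightFace d T) :
    IsNonemptyFace (metricPolyhedron d) (tightFace d T) := by
  -- The sum of the functionals in `T` is minimal exactly when each attains its bound, since `x`
  -- attains all of them.
  refine ⟨fun _ => ⟨LinearMap.toContinuousLinearMap (-∑ e ∈ T, pairSum e), ?_⟩, x, hx⟩
  ext y
  simp only [tightFace, Set.mem_ofPred_eq, LinearMap.coe_toContinuousLinearMap', LinearMap.neg_apply,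
    LinearMap.sum_apply, neg_le_neg_iff]
  refine and_congr_right fun hy => ⟨fun h z hz => ?_, fun h => ?_⟩
  · rw [Finset.sum_congr rfl h]
    exact Finset.sum_le_sum fun e _ => (mem_metricPolyhedron_iff hd).1 hz e
  · have h1 := h x hx.1
    rw [Finset.sum_congr rfl hx.2] at h1
    have h2 := (Finset.sum_eq_sum_iff_of_le
      fun e (_ : e ∈ T) => (mem_metricPolyhedron_iff hd).1 hy e).1
      (le_antisymm (Finset.sum_le_sum fun e _ => (mem_metricPolyhedron_iff hd).1 hy e) h1)
    exact fun e he => (h2 e he).symm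

/-! ### Facets and vertices -/

lemma exists_forall_weight_lt (hd : IsFiniteMetric d) :
    ∃ C : ℝ, 0 < C ∧ ∀ i j, d i j < C := by
  have h0 : ∀ i ∈ univ, 0 ≤ ∑ j, d i j := fun i _ => Finset.sum_nonneg fun j _ => hd.nonneg i j
  refine ⟨1 + ∑ i, ∑ j, d i j, ?_, fun i j => ?_⟩
  · have := Finset.sum_nonneg h0
    linarith
  · have h1 := Finset.single_le_sum h0 (mem_univ i)
    have h2 := Finset.single_le_sum (f := fun j => d i j) (fun j _ => hd.nonneg i j) (mem_univ j)
    linarith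

lemma exists_tightSet_eq_empty (hd : IsFiniteMetric d) :
    ∃ x ∈ metricPolyhedron d, tightSet d x = ∅ := by
  obtain ⟨C, hC, h⟩ := exists_forall_weight_lt hd
  refine ⟨fun _ => C, fun i j => by linarith [h i j], ?_⟩
  ext e
  induction e with | _ i j =>
  simp only [mem_tightSet, pairSum_mk, weight_mk hd, notMem_empty, iff_false]
  linarith [h i j]

lemma exists_tightSet_eq_singleton (hd : IsFiniteMetric d) {e : Sym2 (Fin n)}
    (he : e.IsDiag ∨ 0 < weight d e) : ∃ x ∈ metricPolyhedron d, tightSet d x = {e} := by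
  obtain ⟨C, hC, h⟩ := exists_forall_weight_lt hd
  induction e with | _ i j =>
  rw [weight_mk hd, Sym2.mk_isDiag_iff] at he
  have hij : i = j ∨ i ≠ j ∧ 0 < d i j := by tauto
  -- The witness is `d i j / 2` on `{i, j}` and a large `C` elsewhere. For `i ≠ j` the loops at `i`
  -- and `j` are slack only because `d i j > 0`.
  have key : ∀ a b, (d a b ≤ (if a = i ∨ a = j then d i j / 2 else C) +
      (if b = i ∨ b = j then d i j / 2 else C)) ∧
      ((if a = i ∨ a = j then d i j / 2 else C) +
      (if b = i ∨ b = j then d i j / 2 else C) = d a b ↔ s(a, b) = s(i, j)) := by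
    intro a b
    have hab := h a b
    have hp := hd.nonneg i j
    have hs := hd.symm i j
    have hi := hd.diag i
    have hj := hd.diag j
    rw [Sym2.eq_iff]
    by_cases h1 : a = i ∨ a = j
    · by_cases h2 : b = i ∨ b = j
      · rw [if_pos h1, if_pos h2, add_halves]
        grind
      · rw [if_pos h1, if_neg h2]
        exact ⟨by linarith, fun _ => by linarith, by tauto⟩
    · rw [if_neg h1]
      have hb : 0 ≤ if b = i ∨ b = j then d i j / 2 else C := by split_ifs <;> linarith
      exact ⟨by linarith, fun _ => by linarith, by tauto⟩
  refine ⟨fun k => if k = i ∨ k = j then d i j / 2 else C, fun a b => (key a b).1, ?_⟩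
  ext f
  induction f with | _ a b =>
  rw [mem_tightSet, weight_mk hd, pairSum_mk, mem_singleton]
  exact (key a b).2

lemma edgeVec_ne_zero (e : Sym2 (Fin n)) : edgeVec e ≠ 0 := by
  intro h
  have := sum_edgeVec e
  simp [h] at this

lemma tightFace_empty : tightFace d ∅ = metricPolyhedron d := by
  simp [tightFace]

lemma affDim_metricPolyhedron (hd : IsFiniteMetric d) : affDim (metricPolyhedron d) = n := by
  obtain ⟨x, hx, h⟩ := exists_tightSet_eq_empty hd
  have := affDim_tightFace hd hx (by simp [h])
  simpa [h, tightFace_empty] using this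

lemma isFacet_tightFace (hd : IsFiniteMetric d) {e : Sym2 (Fin n)}
    (he : e.IsDiag ∨ 0 < weight d e) : IsFacet (metricPolyhedron d) (tightFace d {e}) := by
  obtain ⟨x, hx, h⟩ := exists_tightSet_eq_singleton hd he
  rw [← h]
  refine ⟨isNonemptyFace_tightFace hd (mem_tightFace_tightSet hx), ?_⟩
  have := affDim_tightFace hd hx (by simpa [h] using edgeVec_ne_zero e)
  rw [affDim_metricPolyhedron hd]
  simpa [h] using this

/-- At a vertex of a simple `P_d` at most `n` facet-defining constraints are tight. -/
lemma card_le_of_mem_extremePoints (hd : IsFiniteMetric d) (hgen : IsGenericMetric d)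
    {v : Fin n → ℝ} (hv : v ∈ (metricPolyhedron d).extremePoints ℝ) {S : Finset (Sym2 (Fin n))}
    (hS : S ⊆ tightSet d v) (hS' : ∀ e ∈ S, e.IsDiag ∨ 0 < weight d e) : S.card ≤ n := by
  have h := hgen v hv
  rw [affDim_metricPolyhedron hd] at h
  have hinj : Set.InjOn (fun e => tightFace d {e}) (S : Set (Sym2 (Fin n))) := by
    intro e he f hf hef
    obtain ⟨x, hx, hxe⟩ := exists_tightSet_eq_singleton hd (hS' e he)
    have h1 : x ∈ tightFace d {e} := hxe ▸ mem_tightFace_tightSet hx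
    have h2 : x ∈ tightFace d {f} := by
      have : tightFace d {e} = tightFace d {f} := hef
      rwa [← this]
    have h3 : f ∈ tightSet d x := mem_tightSet.2 (h2.2 f (mem_singleton_self f))
    rw [hxe, mem_singleton] at h3
    exact h3.symm
  have hle : ((fun e => tightFace d {e}) '' (S : Set (Sym2 (Fin n)))).encard ≤ n := by
    rw [← h]
    apply Set.encard_le_encard
    rintro _ ⟨e, he, rfl⟩
    refine ⟨isFacet_tightFace hd (hS' e he), hv.1, fun f hf => ?_⟩
    rw [mem_singleton.1 hf]
    exact mem_tightSet.1 (hS he)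
  rw [hinj.encard_image, Set.encard_coe_eq_coe_finsetCard] at hle
  exact_mod_cast hle

/-! ### The row vertices and the strict triangle inequality -/

lemma mem_metricPolyhedron_row (hd : IsFiniteMetric d) (i : Fin n) :
    d i ∈ metricPolyhedron d := by
  intro j k
  rw [← hd.symm j i]
  exact hd.triangle j i k

/-- Coordinate `i` takes its least value `0` at `d i`, hence at both endpoints of a segment through
it. Their other coordinates are then at least `d i k` and average to it. -/
lemma row_mem_extremePoints (hd : IsFiniteMetric d) (i : Fin n) :
    d i ∈ (metricPolyhedron d).extremePoints ℝ := by
  rw [mem_extremePoints_iff_left]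
  refine ⟨mem_metricPolyhedron_row hd i, ?_⟩
  rintro x hx y hy ⟨a, b, ha, hb, hab, h⟩
  have hk : ∀ k, a * x k + b * y k = d i k := fun k => by simpa using congrFun h k
  have hxi : x i = 0 := by
    have h1 := hk i
    have h2 := nonneg_of_mem_metricPolyhedron hd hx i
    have h3 := nonneg_of_mem_metricPolyhedron hd hy i
    rw [hd.diag] at h1
    have h4 := mul_nonneg hb.le h3
    have h5 := mul_nonneg ha.le h2
    have h6 : a * x i = 0 := by linarith
    exact (mul_eq_zero.1 h6).resolve_left ha.ne'
  have hyi : y i = 0 := by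
    have h1 := hk i
    rw [hd.diag, hxi, mul_zero, zero_add] at h1
    exact (mul_eq_zero.1 h1).resolve_left hb.ne'
  ext k
  have h1 := hk k
  have h2 := hx i k
  have h3 := hy i k
  rw [hxi, zero_add] at h2
  rw [hyi, zero_add] at h3
  have h4 := mul_nonneg hb.le (sub_nonneg.2 h3)
  have h5 := mul_nonneg ha.le (sub_nonneg.2 h2)
  have h7 : a * d i k + b * d i k = d i k := by rw [← add_mul, hab, one_mul]
  have h6 : a * (x k - d i k) = 0 := by linarith
  linarith [(mul_eq_zero.1 h6).resolve_left ha.ne']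

/-- At the vertex `d(i, ·)`, the only tight facet-defining constraints are the obvious ones. -/
lemma exists_eq_of_mem_tightSet_row (hd : IsFiniteMetric d) (hgen : IsGenericMetric d) (i : Fin n)
    {e : Sym2 (Fin n)} (he : e ∈ tightSet d (d i)) (he' : e.IsDiag ∨ 0 < weight d e) :
    ∃ k, e = if d i k = 0 then s(k, k) else s(i, k) := by
  by_contra! hne
  -- These are `n` distinct facet-defining tight pairs; where `d i k = 0` the loop at `k` replaces
  -- `{i, k}`, which need not define a facet. A further one would contradict simplicity.
  set f : Fin n → Sym2 (Fin n) := fun k => if d i k = 0 then s(k, k) else s(i, k) with hf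
  have hinj : Function.Injective f := by
    intro a b hab
    simp only [hf] at hab
    have := hd.diag i
    split_ifs at hab <;> rw [Sym2.eq_iff] at hab <;> grind
  have hcard : (insert e (univ.image f)).card = n + 1 := by
    rw [card_insert_of_notMem, card_image_of_injective _ hinj, card_univ, Fintype.card_fin]
    simpa [eq_comm] using hne
  have hle : (insert e (univ.image f)).card ≤ n := by
    apply card_le_of_mem_extremePoints hd hgen (row_mem_extremePoints hd i)
    · intro g hg
      rw [mem_insert, mem_image] at hg
      rcases hg with rfl | ⟨k, -, rfl⟩
      · exact he
      · simp only [hf]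
        split_ifs with h <;> simp [weight_mk hd, hd.diag, h]
    · intro g hg
      rw [mem_insert, mem_image] at hg
      rcases hg with rfl | ⟨k, -, rfl⟩
      · exact he'
      · simp only [hf]
        split_ifs with h
        · simp
        · right
          rw [weight_mk hd]
          exact lt_of_le_of_ne (hd.nonneg i k) (Ne.symm h)
  omega

/-- If `d i j = 0`, pick `m` with `d i m ≠ 0`. Then `{j, m}` is an extra facet at the vertex `d i`.
-/
lemma pos_of_isGenericMetric (hd : IsFiniteMetric d) (hd0 : d ≠ 0) (hgen : IsGenericMetric d)
    {i j : Fin n} (hij : i ≠ j) : 0 < d i j := by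
  by_contra hneg
  have h0 : d i j = 0 := le_antisymm (not_lt.1 hneg) (hd.nonneg i j)
  obtain ⟨m, hm⟩ : ∃ m, d i m ≠ 0 := by
    by_contra! h
    apply hd0
    ext a b
    have h1 := hd.triangle a i b
    rw [hd.symm a i, h a, h b] at h1
    exact le_antisymm (by simpa using h1) (hd.nonneg a b)
  have hjm : d j m = d i m := by
    have h1 := hd.triangle i j m
    have h2 := hd.triangle j i m
    rw [hd.symm j i] at h2
    linarith
  obtain ⟨k, hk⟩ := exists_eq_of_mem_tightSet_row hd hgen i (e := s(j, m))
    (by rw [mem_tightSet, pairSum_mk, weight_mk hd, hjm, h0, zero_add])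
    (by rw [weight_mk hd, hjm]; exact Or.inr (lt_of_le_of_ne (hd.nonneg i m) hm.symm))
  have := hd.diag i
  split_ifs at hk <;> rw [Sym2.eq_iff] at hk <;> grind

/-- Equality would make `{j, k}` tight at the vertex `d i`, one facet too many. -/
lemma triangle_lt (hd : IsFiniteMetric d) (hd0 : d ≠ 0) (hgen : IsGenericMetric d)
    {i j k : Fin n} (hij : i ≠ j) (hik : i ≠ k) : d j k < d i j + d i k := by
  have hpos : ∀ l, l ≠ i → 0 < d i l := fun l hl => pos_of_isGenericMetric hd hd0 hgen hl.symm
  rcases eq_or_ne j k with rfl | hjk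
  · rw [hd.diag]
    linarith [hpos j hij.symm]
  have hle := hd.triangle j i k
  rw [hd.symm j i] at hle
  refine lt_of_le_of_ne hle fun h => ?_
  obtain ⟨l, hl⟩ := exists_eq_of_mem_tightSet_row hd hgen i (e := s(j, k))
    (by rw [mem_tightSet, pairSum_mk, weight_mk hd, h])
    (by rw [weight_mk hd]; exact Or.inr (pos_of_isGenericMetric hd hd0 hgen hjk))
  split_ifs at hl <;> rw [Sym2.eq_iff] at hl <;> grind

lemma isDiag_or_weight_pos (hd : IsFiniteMetric d) (hd0 : d ≠ 0) (hgen : IsGenericMetric d)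
    (e : Sym2 (Fin n)) : e.IsDiag ∨ 0 < weight d e := by
  induction e with | _ i j =>
  rw [weight_mk hd, Sym2.mk_isDiag_iff]
  by_cases h : i = j
  · exact Or.inl h
  · exact Or.inr (pos_of_isGenericMetric hd hd0 hgen h)

/-! ### Independence of the tight constraints -/

lemma isClosed_metricPolyhedron (d : Fin n → Fin n → ℝ) : IsClosed (metricPolyhedron d) := by
  have : metricPolyhedron d = ⋂ i, ⋂ j, {x | d i j ≤ x i + x j} := by
    ext x; simp [metricPolyhedron]
  rw [this]
  exact isClosed_iInter fun i => isClosed_iInter fun j => isClosed_le (by fun_prop) (by fun_prop)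

/-- Every face of `P_d` contains a vertex of `P_d`. -/
lemma exists_mem_extremePoints_tightSet_subset (hd : IsFiniteMetric d) {x : Fin n → ℝ}
    (hx : x ∈ metricPolyhedron d) :
    ∃ v ∈ (metricPolyhedron d).extremePoints ℝ, tightSet d x ⊆ tightSet d v := by
  set F := tightFace d (tightSet d x) with hF
  have hFc : IsClosed F := by
    have : F = metricPolyhedron d ∩ ⋂ e ∈ tightSet d x, {y | pairSum e y = weight d e} := by
      ext y; simp [hF, tightFace]
    rw [this]
    refine (isClosed_metricPolyhedron d).inter (isClosed_biInter fun e _ => ?_)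
    exact isClosed_eq (LinearMap.continuous_of_finiteDimensional _) continuous_const
  -- Minimizing the coordinate sum has a compact solution set even on an unbounded face, since
  -- coordinates are nonnegative. An extreme point of that set is a vertex of `P_d`.
  set l : (Fin n → ℝ) →L[ℝ] ℝ := LinearMap.toContinuousLinearMap (-∑ k, LinearMap.proj k) with hl
  have hly : ∀ y, l y = -∑ k, y k := fun y => by simp [hl]
  have hxF : x ∈ F := mem_tightFace_tightSet hx
  set K := F ∩ Set.Icc 0 (fun _ => ∑ k, x k) with hK
  have hKc : IsCompact K := isCompact_Icc.inter_left hFc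
  have hFK : ∀ y ∈ F, l x ≤ l y → y ∈ K := by
    intro y hy hxy
    rw [hly, hly] at hxy
    have hy0 := nonneg_of_mem_metricPolyhedron hd hy.1
    refine ⟨hy, hy0, fun k => ?_⟩
    have := Finset.single_le_sum (f := y) (fun j _ => hy0 j) (mem_univ k)
    change y k ≤ ∑ k, x k
    linarith
  obtain ⟨y, hyK, hy⟩ := hKc.exists_isMaxOn ⟨x, hFK x hxF le_rfl⟩ l.continuous.continuousOn
  have hmax : ∀ z ∈ F, l z ≤ l y := by
    intro z hz
    by_cases h : l x ≤ l z
    · exact hy (hFK z hz h)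
    · exact (not_le.1 h).le.trans (hy (hFK x hxF le_rfl))
  have hE : IsExposed ℝ F (l.toExposed F) := ContinuousLinearMap.toExposed.isExposed
  have hsub : l.toExposed F ⊆ K := fun z hz => hFK z hz.1 (hz.2 x hxF)
  have hcomp : IsCompact (l.toExposed F) :=
    hKc.of_isClosed_subset (hE.isClosed hFc) hsub
  obtain ⟨v, hv⟩ := hcomp.extremePoints_nonempty ⟨y, hyK.1, hmax⟩
  have hvP : v ∈ (metricPolyhedron d).extremePoints ℝ :=
    (isNonemptyFace_tightFace hd hxF).1.isExtreme.extremePoints_subset_extremePoints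
      (hE.isExtreme.extremePoints_subset_extremePoints hv)
  exact ⟨v, hvP, fun e he => mem_tightSet.2 (hv.1.1.2 e he)⟩

lemma eq_zero_of_mem_extremePoints (hd : IsFiniteMetric d) {v u : Fin n → ℝ}
    (hv : v ∈ (metricPolyhedron d).extremePoints ℝ) (hu : ∀ e ∈ tightSet d v, pairSum e u = 0) :
    u = 0 := by
  obtain ⟨ε, hε, h1⟩ := exists_pos_add_smul_mem hd hv.1 (u := u) fun e he => (hu e he).ge
  obtain ⟨δ, hδ, h2⟩ := exists_pos_add_smul_mem hd hv.1 (u := -u) fun e he => by simp [hu e he]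
  have hs : 0 < ε + δ := by positivity
  -- These weights put `v` strictly between `v + ε • u` and `v - δ • u`.
  have h := (mem_extremePoints_iff_left.1 hv).2 _ h1 _ h2
    ⟨δ / (ε + δ), ε / (ε + δ), by positivity, by positivity, by field_simp; ring, by
      ext k; simp; field_simp; ring⟩
  have h3 : ε • u = 0 := by simpa using h
  exact (smul_eq_zero.1 h3).resolve_left hε.ne'

/-- Pass to a vertex of the face. The tight vectors there span, being jointly orthogonal only to
`0`, and number at most `n` by simplicity. -/
lemma linearIndepOn_tightSet (hd : IsFiniteMetric d) (hd0 : d ≠ 0) (hgen : IsGenericMetric d)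
    {x : Fin n → ℝ} (hx : x ∈ metricPolyhedron d) :
    LinearIndepOn ℝ edgeVec (tightSet d x : Set (Sym2 (Fin n))) := by
  obtain ⟨v, hv, hxv⟩ := exists_mem_extremePoints_tightSet_subset hd hx
  refine LinearIndepOn.mono (s := (tightSet d v : Set (Sym2 (Fin n)))) ?_ (by exact_mod_cast hxv)
  have hcard : (tightSet d v).card ≤ n :=
    card_le_of_mem_extremePoints hd hgen hv subset_rfl
      fun e _ => isDiag_or_weight_pos hd hd0 hgen e
  set A := Matrix.of fun e : tightSet d v => edgeVec (e : Sym2 (Fin n)) with hA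
  have hker : LinearMap.ker A.mulVecLin = ⊥ := by
    rw [LinearMap.ker_eq_bot']
    intro u hu
    refine eq_zero_of_mem_extremePoints hd hv fun e he => ?_
    have := congrFun hu ⟨e, he⟩
    rwa [hA, mulVec_edgeVec] at this
  have hrank : A.rank = n := by
    have := LinearMap.finrank_range_of_inj (LinearMap.ker_eq_bot.1 hker)
    simpa [Matrix.rank] using this
  have hspan : Module.finrank ℝ (Submodule.span ℝ (Set.range A.row)) = n := by
    rw [← Matrix.rank_eq_finrank_span_row, hrank]
  have hge : n ≤ (tightSet d v).card := by
    have := A.rank_le_card_height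
    rw [hrank, Fintype.card_coe] at this
    exact this
  have := linearIndependent_iff_card_eq_finrank_span (b := A.row) (R := ℝ)
  exact this.2 (by rw [Set.finrank, hspan, Fintype.card_coe]; omega)

/-! ### The cells of the subdivision -/

/-- `lam` satisfies the constraints of all pairs of distinct points. -/
def IsHeight (d : Fin n → Fin n → ℝ) (lam : Fin n → ℝ) : Prop :=
  ∀ e : Sym2 (Fin n), ¬ e.IsDiag → weight d e ≤ pairSum e lam

/-- The points `e_i + e_j` for the pairs `{i, j}` in `T`. -/
noncomputable def cellVertices (T : Finset (Sym2 (Fin n))) : Finset (Fin n → ℝ) :=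
  T.map ⟨edgeVec, edgeVec_injective⟩

lemma coe_cellVertices (T : Finset (Sym2 (Fin n))) :
    (cellVertices T : Set (Fin n → ℝ)) = edgeVec '' (T : Set (Sym2 (Fin n))) := by
  simp [cellVertices]

lemma cellVertices_injective :
    Function.Injective (cellVertices : Finset (Sym2 (Fin n)) → Finset (Fin n → ℝ)) :=
  Finset.map_injective _

lemma isHeight_of_mem_metricPolyhedron (hd : IsFiniteMetric d) {x : Fin n → ℝ}
    (hx : x ∈ metricPolyhedron d) : IsHeight d x :=
  fun e _ => (mem_metricPolyhedron_iff hd).1 hx e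

lemma edgePoints_eq (hd : IsFiniteMetric d) {lam : Fin n → ℝ} {G : SimpleGraph (Fin n)}
    (hG : ∀ i j, G.Adj i j ↔ i ≠ j ∧ lam i + lam j = d i j) :
    edgePoints G = (cellVertices (cellEdges d lam) : Set (Fin n → ℝ)) := by
  rw [coe_cellVertices]
  ext x
  constructor
  · rintro ⟨i, j, h, rfl⟩
    rw [hG] at h
    refine ⟨s(i, j), ?_, rfl⟩
    rw [mem_coe, mem_cellEdges, weight_mk hd, Sym2.mk_isDiag_iff]
    exact ⟨h.2, h.1⟩
  · rintro ⟨e, he, rfl⟩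
    induction e with | _ i j =>
    rw [mem_coe, mem_cellEdges, weight_mk hd, Sym2.mk_isDiag_iff] at he
    exact ⟨i, j, (hG i j).2 ⟨he.2, he.1⟩, rfl⟩

lemma mem_hypersimplexSubdivision_iff (hd : IsFiniteMetric d) {s : Finset (Fin n → ℝ)} :
    s ∈ hypersimplexSubdivision d ↔
      s.Nonempty ∧ ∃ lam, IsHeight d lam ∧ s = cellVertices (cellEdges d lam) := by
  refine and_congr_right fun _ => ⟨?_, ?_⟩
  · rintro ⟨G, ⟨lam, h⟩, hs⟩
    refine ⟨lam, fun e he => ?_, ?_⟩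
    · induction e with | _ i j =>
      rw [Sym2.mk_isDiag_iff] at he
      rw [weight_mk hd, pairSum_mk]
      by_cases hadj : G.Adj i j
      · exact ((h i j he).1 hadj).ge
      · exact ((h i j he).2 hadj).le
    · rw [← Finset.coe_inj, hs]
      refine edgePoints_eq hd fun i j => ⟨fun hadj => ⟨hadj.ne, (h i j hadj.ne).1 hadj⟩, ?_⟩
      rintro ⟨hij, heq⟩
      by_contra hadj
      exact ((h i j hij).2 hadj).ne' heq
  · rintro ⟨lam, h, rfl⟩
    let G : SimpleGraph (Fin n) :=
      { Adj := fun i j => i ≠ j ∧ lam i + lam j = d i j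
        symm := ⟨fun i j h => ⟨h.1.symm, by rw [add_comm, h.2, hd.symm]⟩⟩
        loopless := ⟨fun i h => h.1 rfl⟩ }
    refine ⟨G, ⟨lam, fun i j hij => ⟨fun h => h.2, fun hn => ?_⟩⟩,
      (edgePoints_eq hd fun i j => Iff.rfl).symm⟩
    have h1 := h s(i, j) (by simpa using hij)
    rw [weight_mk hd, pairSum_mk] at h1
    exact lt_of_le_of_ne h1 fun heq => hn ⟨hij, heq.symm⟩

/-- If a height is not positive at `i`, then all tight pairs contain `i`. -/
lemma mem_of_apply_nonpos (hd : IsFiniteMetric d) (hd0 : d ≠ 0) (hgen : IsGenericMetric d)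
    {x : Fin n → ℝ} (hx : IsHeight d x) {i : Fin n} (hi : x i ≤ 0)
    {e : Sym2 (Fin n)} (he : pairSum e x = weight d e) : i ∈ e := by
  induction e with | _ j k =>
  rw [Sym2.mem_iff]
  by_contra! h
  -- A tight `{j, k}` avoiding `i` would give `d j k = x j + x k ≥ d i j + d i k`, against the
  -- strict triangle inequality.
  have h1 := hx s(i, j) (by simpa using h.1)
  have h2 := hx s(i, k) (by simpa using h.2)
  have h3 := triangle_lt hd hd0 hgen h.1 h.2
  rw [weight_mk hd, pairSum_mk] at *
  linarith

/-- A positive height lies in `P_d`. Otherwise the cell is a star at some `i`, and all pairs at `i`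
are tight at the vertex `d i`. -/
lemma exists_cellEdges_subset_tightSet (hd : IsFiniteMetric d) (hd0 : d ≠ 0)
    (hgen : IsGenericMetric d) {lam : Fin n → ℝ} (h : IsHeight d lam) :
    ∃ x ∈ metricPolyhedron d, cellEdges d lam ⊆ tightSet d x := by
  by_cases hpos : ∃ i, lam i ≤ 0
  · obtain ⟨i, hi⟩ := hpos
    refine ⟨d i, mem_metricPolyhedron_row hd i, fun e he => ?_⟩
    have := mem_of_apply_nonpos hd hd0 hgen h hi (mem_cellEdges.1 he).1
    obtain ⟨j, rfl⟩ := Sym2.mem_iff_exists.1 this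
    rw [mem_tightSet, pairSum_mk, weight_mk hd, hd.diag, zero_add]
  · push Not at hpos
    refine ⟨lam, (mem_metricPolyhedron_iff hd).2 fun e => ?_,
      fun e he => mem_tightSet.2 (mem_cellEdges.1 he).1⟩
    by_cases he : e.IsDiag
    · induction e with | _ i j =>
      obtain rfl : i = j := by simpa using he
      rw [weight_mk hd, hd.diag, pairSum_mk]
      linarith [hpos i]
    · exact h e he

lemma linearIndepOn_cellEdges (hd : IsFiniteMetric d) (hd0 : d ≠ 0) (hgen : IsGenericMetric d)
    {lam : Fin n → ℝ} (h : IsHeight d lam) :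
    LinearIndepOn ℝ edgeVec (cellEdges d lam : Set (Sym2 (Fin n))) := by
  obtain ⟨x, hx, hsub⟩ := exists_cellEdges_subset_tightSet hd hd0 hgen h
  exact (linearIndepOn_tightSet hd hd0 hgen hx).mono (by exact_mod_cast hsub)

lemma affineIndependent_cellVertices {T : Finset (Sym2 (Fin n))}
    (hT : LinearIndepOn ℝ edgeVec (T : Set (Sym2 (Fin n)))) :
    AffineIndependent ℝ ((↑) : cellVertices T → Fin n → ℝ) := by
  have h := hT.id_image
  rw [← coe_cellVertices] at h
  rw [affineIndependent_iff]
  intro s w _ hw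
  exact linearIndependent_iff'.1 h s w hw

/-- Every subset of a cell is a cell. -/
lemma exists_cellEdges_eq_of_subset (hd : IsFiniteMetric d) (hd0 : d ≠ 0)
    (hgen : IsGenericMetric d) {lam : Fin n → ℝ} (h : IsHeight d lam)
    {T : Finset (Sym2 (Fin n))} (hT : T ⊆ cellEdges d lam) :
    ∃ mu, IsHeight d mu ∧ T = cellEdges d mu := by
  classical
  -- Moving along `u` keeps the pairs in `T` tight and loosens the rest of the cell.
  obtain ⟨u, hu⟩ := exists_forall_pairSum_eq (linearIndepOn_cellEdges hd hd0 hgen h)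
    fun e => if e ∈ T then 0 else 1
  obtain ⟨ε, hε, hlt⟩ := exists_pos_forall_weight_lt d lam u
  have key : ∀ e : Sym2 (Fin n), ¬ e.IsDiag → e ∉ T →
      weight d e < pairSum e (lam + ε • u) := by
    intro e he heT
    rcases (h e he).lt_or_eq with h1 | h1
    · exact hlt e h1
    · have := hu e (mem_cellEdges.2 ⟨h1.symm, he⟩)
      rw [if_neg heT] at this
      rw [map_add, map_smul, this, h1, smul_eq_mul]
      linarith
  have key' : ∀ e ∈ T, pairSum e (lam + ε • u) = weight d e := by
    intro e he
    rw [map_add, map_smul, hu e (hT he), if_pos he, (mem_cellEdges.1 (hT he)).1, smul_zero,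
      add_zero]
  refine ⟨lam + ε • u, fun e he => ?_, ?_⟩
  · by_cases heT : e ∈ T
    · exact (key' e heT).ge
    · exact (key e he heT).le
  · ext e
    rw [mem_cellEdges]
    refine ⟨fun he => ⟨key' e he, (mem_cellEdges.1 (hT he)).2⟩, fun ⟨h1, h2⟩ => ?_⟩
    by_contra heT
    exact (key e h2 heT).ne' h1

lemma mem_convexHull_cellVertices {T : Finset (Sym2 (Fin n))} {x : Fin n → ℝ} :
    x ∈ convexHull ℝ (cellVertices T : Set (Fin n → ℝ)) ↔
      ∃ w : Sym2 (Fin n) → ℝ, (∀ e ∈ T, 0 ≤ w e) ∧ ∑ e ∈ T, w e = 1 ∧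
        ∑ e ∈ T, w e • edgeVec e = x := by
  rw [Finset.mem_convexHull']
  simp only [cellVertices, mem_map, Function.Embedding.coeFn_mk, forall_exists_index, and_imp,
    forall_apply_eq_imp_iff₂, sum_map]
  constructor
  · rintro ⟨w, h⟩
    exact ⟨fun e => w (edgeVec e), h⟩
  · rintro ⟨w, h⟩
    refine ⟨Function.extend edgeVec w 0, ?_⟩
    simpa only [edgeVec_injective.extend_apply] using h

/-! ### Complementary slackness and intersections of cells -/

lemma sum_mul_pairSum {T : Finset (Sym2 (Fin n))} (a : Sym2 (Fin n) → ℝ) (x : Fin n → ℝ) :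
    ∑ e ∈ T, a e * pairSum e x = (∑ e ∈ T, a e • edgeVec e) ⬝ᵥ x := by
  simp [sum_dotProduct, pairSum_eq_dotProduct]

/-- If two nonnegative combinations of the vertices of two cells agree, then the second one is
supported on the first cell. -/
lemma mem_cellEdges_of_sum_eq {lam mu : Fin n → ℝ} (hlam : IsHeight d lam) (hmu : IsHeight d mu)
    {a b : Sym2 (Fin n) → ℝ} (ha : ∀ e ∈ cellEdges d lam, 0 ≤ a e)
    (hb : ∀ e ∈ cellEdges d mu, 0 ≤ b e)
    (hab : ∑ e ∈ cellEdges d lam, a e • edgeVec e = ∑ e ∈ cellEdges d mu, b e • edgeVec e)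
    {e : Sym2 (Fin n)} (he : e ∈ cellEdges d mu) (hbe : b e ≠ 0) : e ∈ cellEdges d lam := by
  have tight : ∀ {x : Fin n → ℝ} (c : Sym2 (Fin n) → ℝ),
      ∑ f ∈ cellEdges d x, c f * weight d f = ∑ f ∈ cellEdges d x, c f * pairSum f x := by
    intro x c
    exact Finset.sum_congr rfl fun f hf => by rw [(mem_cellEdges.1 hf).1]
  have hle : ∀ f ∈ cellEdges d mu, b f * weight d f ≤ b f * pairSum f lam := fun f hf =>
    mul_le_mul_of_nonneg_left (hlam f (mem_cellEdges.1 hf).2) (hb f hf)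
  have hle' : ∀ f ∈ cellEdges d lam, a f * weight d f ≤ a f * pairSum f mu := fun f hf =>
    mul_le_mul_of_nonneg_left (hmu f (mem_cellEdges.1 hf).2) (ha f hf)
  -- With `z` the common sum, these say `z ⬝ᵥ mu ≤ z ⬝ᵥ lam` and the reverse. Equality holds
  -- termwise, so each pair with `b e ≠ 0` is tight at `lam`.
  have h1 := Finset.sum_le_sum hle
  have h2 := Finset.sum_le_sum hle'
  have h3 := sum_mul_pairSum (T := cellEdges d lam) a lam
  have h4 := sum_mul_pairSum (T := cellEdges d mu) b lam
  have h5 := sum_mul_pairSum (T := cellEdges d lam) a mu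
  have h6 := sum_mul_pairSum (T := cellEdges d mu) b mu
  rw [hab] at h3 h5
  rw [tight] at h1 h2
  have h7 := (Finset.sum_eq_sum_iff_of_le hle).1 (by rw [tight]; linarith) e he
  exact mem_cellEdges.2 ⟨(mul_left_cancel₀ hbe h7).symm, (mem_cellEdges.1 he).2⟩

lemma convexHull_inter_subset {lam mu : Fin n → ℝ} (hlam : IsHeight d lam) (hmu : IsHeight d mu) :
    convexHull ℝ (cellVertices (cellEdges d lam) : Set (Fin n → ℝ)) ∩
      convexHull ℝ (cellVertices (cellEdges d mu) : Set (Fin n → ℝ)) ⊆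
    convexHull ℝ ((cellVertices (cellEdges d lam) : Set (Fin n → ℝ)) ∩
      cellVertices (cellEdges d mu)) := by
  classical
  rintro x ⟨hx1, hx2⟩
  obtain ⟨a, ha, -, hax⟩ := mem_convexHull_cellVertices.1 hx1
  obtain ⟨b, hb, hb1, hbx⟩ := mem_convexHull_cellVertices.1 hx2
  have hmem : x ∈ convexHull ℝ
      (cellVertices (cellEdges d mu ∩ cellEdges d lam) : Set (Fin n → ℝ)) := by
    have hz : ∀ e ∈ cellEdges d mu, e ∉ cellEdges d mu ∩ cellEdges d lam → b e = 0 := by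
      intro e he hne
      by_contra hbe
      exact hne (mem_inter.2
        ⟨he, mem_cellEdges_of_sum_eq hlam hmu ha hb (hax.trans hbx.symm) he hbe⟩)
    refine mem_convexHull_cellVertices.2 ⟨b, fun e he => hb e (mem_inter.1 he).1, ?_, ?_⟩
    · rw [← hb1]
      exact Finset.sum_subset inter_subset_left hz
    · rw [← hbx]
      exact Finset.sum_subset inter_subset_left fun e he hne => by rw [hz e he hne, zero_smul]
  refine convexHull_mono (Set.subset_inter ?_ ?_) hmem
  · exact_mod_cast Finset.map_subset_map.2 (inter_subset_right (s₁ := cellEdges d mu))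
  · exact_mod_cast Finset.map_subset_map.2 (inter_subset_left (s₁ := cellEdges d mu))

/-! ### The cells cover the hypersimplex -/

lemma exists_isMinOn_metricPolyhedron (hd : IsFiniteMetric d) {x : Fin n → ℝ} (hx : ∀ i, 0 ≤ x i) :
    ∃ lam ∈ metricPolyhedron d, ∀ y ∈ metricPolyhedron d, x ⬝ᵥ lam ≤ x ⬝ᵥ y := by
  obtain ⟨C, hC, h⟩ := exists_forall_weight_lt hd
  have hK : IsCompact (metricPolyhedron d ∩ Set.Icc 0 (fun _ => C)) :=
    isCompact_Icc.inter_left (isClosed_metricPolyhedron d)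
  have hne : (metricPolyhedron d ∩ Set.Icc 0 (fun _ => C)).Nonempty :=
    ⟨fun _ => C, fun i j => by linarith [h i j], fun _ => hC.le, le_rfl⟩
  obtain ⟨lam, hlam, hmin⟩ := hK.exists_isMinOn hne (f := fun y => x ⬝ᵥ y) (by
    unfold dotProduct; fun_prop)
  refine ⟨lam, hlam.1, fun y hy => ?_⟩
  have hy0 := nonneg_of_mem_metricPolyhedron hd hy
  -- Truncation at `C` stays in `P_d` and does not raise the objective, so the minimum over the box
  -- is global.
  have hmem : (fun k => min (y k) C) ∈ metricPolyhedron d ∩ Set.Icc 0 (fun _ => C) := by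
    refine ⟨fun i j => ?_, fun k => le_min (hy0 k) hC.le, fun k => min_le_right _ _⟩
    have h1 := hy i j
    have h2 := h i j
    have h3 := hy0 i
    have h4 := hy0 j
    change d i j ≤ min (y i) C + min (y j) C
    rcases min_cases (y i) C with ⟨h5, _⟩ | ⟨h5, _⟩ <;>
      rcases min_cases (y j) C with ⟨h6, _⟩ | ⟨h6, _⟩ <;> rw [h5, h6] <;> linarith
  refine (hmin hmem).trans (Finset.sum_le_sum fun k _ => ?_)
  exact mul_le_mul_of_nonneg_left (min_le_left _ _) (hx k)

/-- At an optimal point with independent tight constraints, the objective is a nonnegative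
combination of the tight constraints. -/
lemma exists_eq_sum_smul_edgeVec (hd : IsFiniteMetric d) {x lam : Fin n → ℝ}
    (hlam : lam ∈ metricPolyhedron d) (hmin : ∀ y ∈ metricPolyhedron d, x ⬝ᵥ lam ≤ x ⬝ᵥ y)
    (hT : LinearIndepOn ℝ edgeVec (tightSet d lam : Set (Sym2 (Fin n)))) :
    ∃ a : Sym2 (Fin n) → ℝ, (∀ e ∈ tightSet d lam, 0 ≤ a e) ∧
      ∑ e ∈ tightSet d lam, a e • edgeVec e = x := by
  classical
  have hdir : ∀ u, (∀ e ∈ tightSet d lam, 0 ≤ pairSum e u) → 0 ≤ x ⬝ᵥ u := by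
    intro u hu
    obtain ⟨ε, hε, hmem⟩ := exists_pos_add_smul_mem hd hlam hu
    have := hmin _ hmem
    rw [dotProduct_add, dotProduct_smul, smul_eq_mul] at this
    exact nonneg_of_mul_nonneg_right (by linarith) hε
  -- `u` is dual to the tight constraints. Each `u f` is a feasible direction, so optimality makes
  -- the coefficient `x ⬝ᵥ u f` nonnegative.
  choose u hu using fun f => exists_forall_pairSum_eq hT fun e => if e = f then 1 else 0
  refine ⟨fun f => x ⬝ᵥ u f, fun f _ => hdir _ fun e he => ?_, ?_⟩
  · rw [hu f e he]
    split_ifs <;> norm_num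
  · have hw : ∀ w, (∑ f ∈ tightSet d lam, (x ⬝ᵥ u f) • edgeVec f) ⬝ᵥ w = x ⬝ᵥ w := by
      intro w
      set z := w - ∑ f ∈ tightSet d lam, pairSum f w • u f with hz
      have hz0 : ∀ e ∈ tightSet d lam, pairSum e z = 0 := by
        intro e he
        rw [hz, map_sub, map_sum, sub_eq_zero]
        rw [Finset.sum_eq_single e]
        · rw [map_smul, hu e e he, if_pos rfl, smul_eq_mul, mul_one]
        · intro f _ hfe
          rw [map_smul, hu f e he, if_neg hfe.symm, smul_zero]
        · intro h; exact absurd he h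
      have h1 := hdir z fun e he => (hz0 e he).ge
      have h2 := hdir (-z) fun e he => by rw [map_neg, hz0 e he, neg_zero]
      rw [dotProduct_neg] at h2
      have h3 : x ⬝ᵥ z = 0 := by linarith
      rw [hz, dotProduct_sub, dotProduct_sum, sub_eq_zero] at h3
      rw [h3, ← sum_mul_pairSum]
      exact Finset.sum_congr rfl fun f _ => by rw [dotProduct_smul, smul_eq_mul, mul_comm]
    ext k
    simpa using hw (Pi.single k 1)

lemma exists_mem_convexHull_cell (hd : IsFiniteMetric d) (hd0 : d ≠ 0) (hgen : IsGenericMetric d)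
    {x : Fin n → ℝ} (hx0 : ∀ i, 0 ≤ x i) (hx1 : ∀ i, x i ≤ 1) (hx2 : ∑ i, x i = 2) :
    ∃ lam, IsHeight d lam ∧
      x ∈ convexHull ℝ (cellVertices (cellEdges d lam) : Set (Fin n → ℝ)) := by
  obtain ⟨lam, hlam, hmin⟩ := exists_isMinOn_metricPolyhedron hd hx0
  obtain ⟨a, ha, hax⟩ := exists_eq_sum_smul_edgeVec hd hlam hmin
    (linearIndepOn_tightSet hd hd0 hgen hlam)
  have hheight := isHeight_of_mem_metricPolyhedron hd hlam
  have hsum : ∑ e ∈ tightSet d lam, a e = 1 := by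
    have : ∑ e ∈ tightSet d lam, a e * 2 = 2 := by
      refine Eq.trans ?_ hx2
      rw [← hax]
      simp only [Finset.sum_apply, Pi.smul_apply, smul_eq_mul]
      rw [Finset.sum_comm]
      exact Finset.sum_congr rfl fun e _ => by rw [← Finset.mul_sum, sum_edgeVec]
    rw [← Finset.sum_mul] at this
    linarith
  have hdiag : ∀ e ∈ tightSet d lam, e.IsDiag → a e = 0 := by
    intro e he hed
    induction e with | _ i j =>
    obtain rfl : i = j := by simpa using hed
    have hi : lam i ≤ 0 := by
      have := mem_tightSet.1 he
      rw [pairSum_mk, weight_mk hd, hd.diag] at this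
      linarith
    -- All tight pairs contain `i`, so `x i ≥ ∑ a f = 1 ≥ x i`. Equality is termwise, but the loop
    -- contributes `2 * a`, so its coefficient vanishes.
    have hge : ∀ f ∈ tightSet d lam, a f ≤ a f * edgeVec f i := by
      intro f hf
      have hif := mem_of_apply_nonpos hd hd0 hgen hheight hi (mem_tightSet.1 hf)
      obtain ⟨j, rfl⟩ := Sym2.mem_iff_exists.1 hif
      refine le_mul_of_one_le_right (ha _ hf) ?_
      simp only [edgeVec_mk, Pi.add_apply, Pi.single_eq_same, le_add_iff_nonneg_right,
        Pi.single_apply]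
      split_ifs <;> norm_num
    have hxi : ∑ f ∈ tightSet d lam, a f * edgeVec f i = x i := by
      rw [← hax]; simp
    have heq := (Finset.sum_eq_sum_iff_of_le hge).1
      (le_antisymm (Finset.sum_le_sum hge) (by rw [hxi, hsum]; exact hx1 i)) _ he
    simp at heq
    linarith
  have hz : ∀ e ∈ tightSet d lam, e ∉ cellEdges d lam → a e = 0 := by
    intro e he hne
    apply hdiag e he
    by_contra h
    exact hne (mem_cellEdges.2 ⟨mem_tightSet.1 he, h⟩)
  have hsub : cellEdges d lam ⊆ tightSet d lam :=
    fun e he => mem_tightSet.2 (mem_cellEdges.1 he).1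
  refine ⟨lam, hheight, mem_convexHull_cellVertices.2 ⟨a, fun e he => ha e (hsub he), ?_, ?_⟩⟩
  · rw [← hsum]
    exact Finset.sum_subset hsub hz
  · rw [← hax]
    exact Finset.sum_subset hsub fun e he hne => by rw [hz e he hne, zero_smul]

lemma secondHypersimplex_subset :
    secondHypersimplex n ⊆ {x | (∀ i, 0 ≤ x i) ∧ (∀ i, x i ≤ 1) ∧ ∑ i, x i = 2} := by
  apply convexHull_min
  · rintro _ ⟨i, j, hij, rfl⟩
    have h1 : ¬ s(i, j).IsDiag := by simpa using hij
    refine ⟨edgeVec_nonneg s(i, j), fun k => ?_, sum_edgeVec s(i, j)⟩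
    by_cases hk : k ∈ s(i, j)
    · exact (edgeVec_apply_of_mem h1 hk).le
    · exact (edgeVec_apply_of_notMem hk).le.trans zero_le_one
  · rintro x ⟨hx0, hx1, hx2⟩ y ⟨hy0, hy1, hy2⟩ a b ha hb hab
    refine ⟨fun i => ?_, fun i => ?_, ?_⟩
    · have := mul_nonneg ha (hx0 i)
      have := mul_nonneg hb (hy0 i)
      simp only [Pi.add_apply, Pi.smul_apply, smul_eq_mul]
      linarith
    · have := mul_le_mul_of_nonneg_left (hx1 i) ha
      have := mul_le_mul_of_nonneg_left (hy1 i) hb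
      simp only [Pi.add_apply, Pi.smul_apply, smul_eq_mul]
      linarith
    · simp only [Pi.add_apply, Pi.smul_apply, smul_eq_mul, Finset.sum_add_distrib,
        ← Finset.mul_sum, hx2, hy2]
      rw [← add_mul, hab, one_mul]

lemma convexHull_cellVertices_subset (lam : Fin n → ℝ) :
    convexHull ℝ (cellVertices (cellEdges d lam) : Set (Fin n → ℝ)) ⊆ secondHypersimplex n := by
  apply convexHull_mono
  rw [coe_cellVertices]
  rintro _ ⟨e, he, rfl⟩
  induction e with | _ i j =>
  exact ⟨i, j, by simpa using (mem_cellEdges.1 he).2, rfl⟩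

lemma mem_secondHypersimplex_iff (hd : IsFiniteMetric d) (hd0 : d ≠ 0) (hgen : IsGenericMetric d)
    {x : Fin n → ℝ} :
    x ∈ secondHypersimplex n ↔ (∀ i, 0 ≤ x i) ∧ (∀ i, x i ≤ 1) ∧ ∑ i, x i = 2 := by
  refine ⟨fun h => secondHypersimplex_subset h, fun ⟨h0, h1, h2⟩ => ?_⟩
  obtain ⟨lam, -, h⟩ := exists_mem_convexHull_cell hd hd0 hgen h0 h1 h2
  exact convexHull_cellVertices_subset lam h

theorem isTriangulationOf_hypersimplexSubdivision (hd : IsFiniteMetric d) (hd0 : d ≠ 0)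
    (hgen : IsGenericMetric d) :
    IsTriangulationOf (hypersimplexSubdivision d) (secondHypersimplex n) := by
  classical
  refine ⟨{ faces := hypersimplexSubdivision d
            isRelLowerSet_faces := ?_
            indep := ?_
            inter_subset_convexHull := ?_ }, rfl, ?_⟩
  · intro s hs
    refine ⟨hs.1, fun t hts ht => ?_⟩
    obtain ⟨-, lam, hlam, rfl⟩ := (mem_hypersimplexSubdivision_iff hd).1 hs
    obtain ⟨T, hT, rfl⟩ := Finset.subset_map_iff.1 hts
    obtain ⟨mu, hmu, rfl⟩ := exists_cellEdges_eq_of_subset hd hd0 hgen hlam hT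
    exact (mem_hypersimplexSubdivision_iff hd).2 ⟨ht, mu, hmu, rfl⟩
  · intro s hs
    obtain ⟨-, lam, hlam, rfl⟩ := (mem_hypersimplexSubdivision_iff hd).1 hs
    exact affineIndependent_cellVertices (linearIndepOn_cellEdges hd hd0 hgen hlam)
  · intro s t hs ht
    obtain ⟨-, lam, hlam, rfl⟩ := (mem_hypersimplexSubdivision_iff hd).1 hs
    obtain ⟨-, mu, hmu, rfl⟩ := (mem_hypersimplexSubdivision_iff hd).1 ht
    exact convexHull_inter_subset hlam hmu
  · ext x
    rw [Geometry.SimplicialComplex.mem_space_iff]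
    constructor
    · rintro ⟨s, hs, hx⟩
      obtain ⟨-, lam, hlam, rfl⟩ := (mem_hypersimplexSubdivision_iff hd).1 hs
      exact convexHull_cellVertices_subset lam hx
    · intro hx
      obtain ⟨h0, h1, h2⟩ := secondHypersimplex_subset hx
      obtain ⟨lam, hlam, h⟩ := exists_mem_convexHull_cell hd hd0 hgen h0 h1 h2
      refine ⟨_, (mem_hypersimplexSubdivision_iff hd).2 ⟨?_, lam, hlam, rfl⟩, h⟩
      exact_mod_cast convexHull_nonempty_iff.1 ⟨x, h⟩

/-! ### Interior cells -/

/-- A part of `Q` on which a linear functional attains its minimum over `Q` lies in the relative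
boundary of `Q`, unless the functional is constant on `Q`. -/
lemma subset_intrinsicFrontier {Q s : Set (Fin n → ℝ)} (f : (Fin n → ℝ) →ₗ[ℝ] ℝ) {c : ℝ}
    (hs : s ⊆ Q) (hQ : ∀ x ∈ Q, c ≤ f x) (hc : ∀ x ∈ s, f x = c) {y : Fin n → ℝ} (hy : y ∈ Q)
    (hyc : f y ≠ c) : s ⊆ intrinsicFrontier ℝ Q := by
  intro x hx
  by_contra hnot
  have hxQ : x ∈ intrinsicInterior ℝ Q := by
    have h1 : x ∈ intrinsicFrontier ℝ Q ∪ intrinsicInterior ℝ Q := by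
      rw [intrinsicFrontier_union_intrinsicInterior]
      exact subset_intrinsicClosure (hs hx)
    exact h1.resolve_left hnot
  obtain ⟨x', hx', rfl⟩ := mem_intrinsicInterior.1 hxQ
  -- Prolonging the segment from `y` slightly past `x'` (negative `t`) stays in `Q` but pushes `f`
  -- below `c`.
  let g : ℝ → affineSpan ℝ Q := fun t =>
    ⟨AffineMap.lineMap (x' : Fin n → ℝ) y t,
      AffineMap.lineMap_mem t x'.2 (subset_affineSpan ℝ Q hy)⟩
  have hg : Continuous g := AffineMap.lineMap_continuous.subtype_mk _
  have hg0 : g 0 = x' := Subtype.ext (AffineMap.lineMap_apply_zero _ _)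
  have hnhds : ∀ᶠ t in nhdsWithin (0 : ℝ) (Set.Iio 0), g t ∈ interior ((↑) ⁻¹' Q : Set (affineSpan ℝ Q)) := by
    refine Filter.Eventually.filter_mono nhdsWithin_le_nhds ?_
    exact hg.continuousAt.eventually_mem (isOpen_interior.mem_nhds (by rwa [hg0]))
  obtain ⟨t, ht, htneg⟩ := (hnhds.and self_mem_nhdsWithin).exists
  have h1 : c ≤ f (AffineMap.lineMap (x' : Fin n → ℝ) y t) :=
    hQ _ (interior_subset (s := ((↑) ⁻¹' Q : Set (affineSpan ℝ Q))) ht)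
  rw [AffineMap.lineMap_apply_module', map_add, map_smul, map_sub, hc _ hx, smul_eq_mul] at h1
  have h2 : 0 < f y - c := sub_pos.2 (lt_of_le_of_ne (hQ y hy) hyc.symm)
  have h3 := mul_neg_of_neg_of_pos (Set.mem_Iio.1 htneg) h2
  linarith

/-- A cell missing `k` lies in the boundary piece `x k = 0`. -/
lemma forall_exists_mem_of_mem_interiorFaces (hn : 2 ≤ n) {lam : Fin n → ℝ}
    (h : cellVertices (cellEdges d lam) ∈
      interiorFaces (hypersimplexSubdivision d) (secondHypersimplex n)) (k : Fin n) :
    ∃ e ∈ cellEdges d lam, k ∈ e := by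
  by_contra! hk
  apply h.2
  have : Nontrivial (Fin n) := Fin.nontrivial_iff_two_le.2 hn
  obtain ⟨j, hj⟩ := exists_ne k
  refine subset_intrinsicFrontier (LinearMap.proj k) (c := 0)
    (convexHull_cellVertices_subset lam) (fun x hx => (secondHypersimplex_subset hx).1 k) ?_
    (y := edgeVec s(k, j)) (subset_convexHull _ _ ⟨k, j, hj.symm, rfl⟩) ?_
  · intro x hx
    obtain ⟨w, -, -, rfl⟩ := mem_convexHull_cellVertices.1 hx
    rw [LinearMap.proj_apply, Finset.sum_apply]
    exact Finset.sum_eq_zero fun e he => by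
      rw [Pi.smul_apply, edgeVec_apply_of_notMem (hk e he), smul_zero]
  · rw [LinearMap.proj_apply, edgeVec_apply_of_mem (by simpa using hj.symm) (by simp)]
    exact one_ne_zero

lemma notMem_intrinsicFrontier (hd : IsFiniteMetric d) (hd0 : d ≠ 0) (hgen : IsGenericMetric d)
    {x : Fin n → ℝ} (hx0 : ∀ i, 0 < x i) (hx1 : ∀ i, x i < 1) :
    x ∉ intrinsicFrontier ℝ (secondHypersimplex n) := by
  intro h
  obtain ⟨y, hy, rfl⟩ := mem_intrinsicFrontier.1 h
  refine hy.2 ?_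
  let A : AffineSubspace ℝ (Fin n → ℝ) :=
    { carrier := {z | ∑ i, z i = 2}
      smul_vsub_vadd_mem' := by
        intro c p q r hp hq hr
        simp only [Set.mem_ofPred_eq] at *
        simp [Finset.sum_add_distrib, ← Finset.mul_sum, hp, hq, hr] }
  have hA : affineSpan ℝ (secondHypersimplex n) ≤ A :=
    affineSpan_le.2 fun z hz => (secondHypersimplex_subset hz).2.2
  refine mem_interior.2 ⟨{z | ∀ i, 0 < (z : Fin n → ℝ) i ∧ (z : Fin n → ℝ) i < 1}, ?_, ?_,
    fun i => ⟨hx0 i, hx1 i⟩⟩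
  · intro z hz
    exact (mem_secondHypersimplex_iff hd hd0 hgen).2
      ⟨fun i => (hz i).1.le, fun i => (hz i).2.le, hA z.2⟩
  · have : {z : affineSpan ℝ (secondHypersimplex n) |
        ∀ i, 0 < (z : Fin n → ℝ) i ∧ (z : Fin n → ℝ) i < 1} =
        ⋂ i, ({z : affineSpan ℝ (secondHypersimplex n) | 0 < (z : Fin n → ℝ) i} ∩
          {z : affineSpan ℝ (secondHypersimplex n) | (z : Fin n → ℝ) i < 1}) := by
      ext z; simp
    rw [this]
    refine isOpen_iInter_of_finite fun i => ?_
    have hc : Continuous fun z : affineSpan ℝ (secondHypersimplex n) => (z : Fin n → ℝ) i :=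
      (continuous_apply i).comp continuous_subtype_val
    exact (isOpen_lt continuous_const hc).inter (isOpen_lt hc continuous_const)

/-- The barycentre of the cell has every coordinate strictly between `0` and `1`. -/
lemma not_subset_intrinsicFrontier (hd : IsFiniteMetric d) (hd0 : d ≠ 0) (hgen : IsGenericMetric d)
    {lam : Fin n → ℝ} (hne : (cellEdges d lam).Nonempty)
    (hmem : ∀ k, ∃ e ∈ cellEdges d lam, k ∈ e) (hnot : ∀ k, ∃ e ∈ cellEdges d lam, k ∉ e) :
    ¬ convexHull ℝ (cellVertices (cellEdges d lam) : Set (Fin n → ℝ)) ⊆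
      intrinsicFrontier ℝ (secondHypersimplex n) := by
  intro hsub
  set T := cellEdges d lam with hT
  have hpos : (0 : ℝ) < T.card := by exact_mod_cast hne.card_pos
  have hx : ∑ e ∈ T, (T.card : ℝ)⁻¹ • edgeVec e ∈
      convexHull ℝ (cellVertices T : Set (Fin n → ℝ)) := by
    refine mem_convexHull_cellVertices.2 ⟨fun _ => (T.card : ℝ)⁻¹, fun _ _ => by positivity, ?_, rfl⟩
    rw [Finset.sum_const, nsmul_eq_mul, mul_inv_cancel₀ hpos.ne']
  have hk : ∀ k, (∑ e ∈ T, (T.card : ℝ)⁻¹ • edgeVec e) k =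
      (T.card : ℝ)⁻¹ * ∑ e ∈ T, edgeVec e k := fun k => by
    simp [Finset.mul_sum]
  refine notMem_intrinsicFrontier hd hd0 hgen (fun k => ?_) (fun k => ?_) (hsub hx)
  · rw [hk]
    refine mul_pos (inv_pos.2 hpos) (Finset.sum_pos' (fun e _ => edgeVec_nonneg e k) ?_)
    obtain ⟨e, he, hke⟩ := hmem k
    exact ⟨e, he, edgeVec_pos_iff.2 hke⟩
  · rw [hk, inv_mul_lt_one₀ hpos]
    have hle : ∀ e ∈ T, edgeVec e k ≤ 1 := by
      intro e he
      by_cases hke : k ∈ e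
      · exact (edgeVec_apply_of_mem (mem_cellEdges.1 he).2 hke).le
      · exact (edgeVec_apply_of_notMem hke).le.trans zero_le_one
    obtain ⟨e, he, hke⟩ := hnot k
    calc ∑ e ∈ T, edgeVec e k < ∑ _e ∈ T, (1 : ℝ) :=
          Finset.sum_lt_sum hle ⟨e, he, by rw [edgeVec_apply_of_notMem hke]; exact one_pos⟩
      _ = T.card := by simp

/-- For `n = 2` the only edge is a star, so the barycentre test fails; but the hypersimplex is a
point. -/
lemma intrinsicFrontier_secondHypersimplex_two {d : Fin 2 → Fin 2 → ℝ} (hd : IsFiniteMetric d)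
    (hd0 : d ≠ 0) (hgen : IsGenericMetric d) :
    intrinsicFrontier ℝ (secondHypersimplex 2) = ∅ := by
  have : secondHypersimplex 2 = {fun _ => 1} := by
    ext x
    rw [mem_secondHypersimplex_iff hd hd0 hgen, Set.mem_singleton_iff, funext_iff]
    simp only [Fin.forall_fin_two, Fin.sum_univ_two]
    constructor
    · rintro ⟨-, ⟨h0, h1⟩, h2⟩
      constructor <;> linarith
    · rintro ⟨h0, h1⟩
      rw [h0, h1]
      norm_num
  rw [this, intrinsicFrontier_singleton]

/-! ### Edge covers -/

lemma le_two_mul_card_of_cover {T : Finset (Sym2 (Fin n))} (hT : ∀ k, ∃ e ∈ T, k ∈ e) :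
    n ≤ 2 * T.card := by
  classical
  have h1 : (univ : Finset (Fin n)) ⊆ T.biUnion Sym2.toFinset := by
    intro k _
    obtain ⟨e, he, hk⟩ := hT k
    exact mem_biUnion.2 ⟨e, he, Sym2.mem_toFinset.2 hk⟩
  have h2 := (card_le_card h1).trans (card_biUnion_le_card_mul T Sym2.toFinset 2 fun e _ => by
    rw [Sym2.card_toFinset]; split_ifs <;> omega)
  rw [card_univ, Fintype.card_fin] at h2
  omega

lemma mk_mem_of_star {T : Finset (Sym2 (Fin n))} (hT : ∀ k, ∃ e ∈ T, k ∈ e) {i : Fin n}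
    (hi : ∀ e ∈ T, i ∈ e) {k : Fin n} (hk : k ≠ i) : s(i, k) ∈ T := by
  obtain ⟨e, he, hke⟩ := hT k
  rwa [← (Sym2.mem_and_mem_iff hk.symm).1 ⟨hi e he, hke⟩]

lemma le_card_of_star {T : Finset (Sym2 (Fin n))} (hT : ∀ k, ∃ e ∈ T, k ∈ e) {i : Fin n}
    (hi : ∀ e ∈ T, i ∈ e) : n ≤ T.card + 1 := by
  classical
  have hsub : (univ.erase i).image (fun k => s(i, k)) ⊆ T := by
    intro e he
    obtain ⟨k, hk, rfl⟩ := mem_image.1 he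
    exact mk_mem_of_star hT hi (ne_of_mem_erase hk)
  have h := card_le_card hsub
  rw [card_image_of_injective _ fun a b hab => Sym2.congr_right.1 hab,
    card_erase_of_mem (mem_univ i), card_univ, Fintype.card_fin] at h
  omega

lemma le_card_of_star_of_loop {T : Finset (Sym2 (Fin n))} (hT : ∀ k, ∃ e ∈ T, k ∈ e) {i : Fin n}
    (hi : ∀ e ∈ T, i ∈ e) (hii : s(i, i) ∈ T) : n ≤ T.card := by
  classical
  have hsub : univ.image (fun k => s(i, k)) ⊆ T := by
    intro e he
    obtain ⟨k, -, rfl⟩ := mem_image.1 he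
    rcases eq_or_ne k i with rfl | hk
    · exact hii
    · exact mk_mem_of_star hT hi hk
  have h := card_le_card hsub
  rwa [card_image_of_injective _ fun a b hab => Sym2.congr_right.1 hab, card_univ,
    Fintype.card_fin] at h

/-- The cells whose graphs are edge covers with `⌈n / 2⌉` edges. -/
def minimalCoverCells (d : Fin n → Fin n → ℝ) : Set (Finset (Sym2 (Fin n))) :=
  {T | (∃ lam, IsHeight d lam ∧ T = cellEdges d lam) ∧ (∀ k, ∃ e ∈ T, k ∈ e) ∧
    T.card = (n + 1) / 2}

/-- The edge covers with `⌈n / 2⌉` edges that are the sets of tight constraints, without loops, at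
points of `P_d`. -/
def minimalCoverTightSets (d : Fin n → Fin n → ℝ) : Set (Finset (Sym2 (Fin n))) :=
  {T | (∃ x ∈ metricPolyhedron d, T = tightSet d x) ∧ (∀ e ∈ T, ¬ e.IsDiag) ∧
    (∀ k, ∃ e ∈ T, k ∈ e) ∧ T.card = (n + 1) / 2}

lemma minimalCoverTightSets_subset (hd : IsFiniteMetric d) :
    minimalCoverTightSets d ⊆ minimalCoverCells d := by
  rintro _ ⟨⟨x, hx, rfl⟩, hdiag, hcov, hcard⟩
  exact ⟨⟨x, isHeight_of_mem_metricPolyhedron hd hx, (cellEdges_eq_tightSet hdiag).symm⟩,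
    hcov, hcard⟩

/-- A nonpositive coordinate forces a star with at least `n - 1` edges, more than `⌈n/2⌉` once `n ≥
4`. For `n = 2` the height is replaced by a constant. -/
lemma minimalCoverCells_subset (hd : IsFiniteMetric d) (hd0 : d ≠ 0) (hgen : IsGenericMetric d)
    (hn : 2 ≤ n) (hn3 : n ≠ 3) : minimalCoverCells d ⊆ minimalCoverTightSets d := by
  rintro _ ⟨⟨lam, hlam, rfl⟩, hcov, hcard⟩
  suffices h : ∃ mu, IsHeight d mu ∧ cellEdges d mu = cellEdges d lam ∧ ∀ i, 0 < mu i by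
    obtain ⟨mu, hmu, heq, hpos⟩ := h
    have hdiag : ∀ i, weight d s(i, i) < pairSum s(i, i) mu := by
      intro i
      rw [weight_mk hd, hd.diag, pairSum_mk]
      linarith [hpos i]
    have hmem : mu ∈ metricPolyhedron d := by
      refine (mem_metricPolyhedron_iff hd).2 fun e => ?_
      by_cases he : e.IsDiag
      · induction e with | _ i j =>
        obtain rfl : i = j := by simpa using he
        exact (hdiag i).le
      · exact hmu e he
    have hloop : ∀ e ∈ tightSet d mu, ¬ e.IsDiag := by
      intro e he hed
      induction e with | _ i j =>
      obtain rfl : i = j := by simpa using hed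
      exact (hdiag i).ne' (mem_tightSet.1 he)
    refine ⟨⟨mu, hmem, ?_⟩, fun e he => (mem_cellEdges.1 he).2, hcov, hcard⟩
    rw [← heq, cellEdges_eq_tightSet hloop]
  rcases eq_or_ne n 2 with rfl | hn2
  · have h01 : ∀ e : Sym2 (Fin 2), ¬ e.IsDiag → e = s(0, 1) := by decide
    have hpos := pos_of_isGenericMetric hd hd0 hgen (i := (0 : Fin 2)) (j := 1) (by decide)
    obtain ⟨e, he, -⟩ := hcov 0
    have hmem : s(0, 1) ∈ cellEdges d lam := h01 e (mem_cellEdges.1 he).2 ▸ he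
    have hw : weight d s(0, 1) = pairSum s((0 : Fin 2), 1) fun _ => d 0 1 / 2 := by
      rw [weight_mk hd, pairSum_mk, add_halves]
    refine ⟨fun _ => d 0 1 / 2, fun f hf => ?_, ?_, fun _ => half_pos hpos⟩
    · rw [h01 f hf]
      exact hw.le
    · ext f
      constructor
      · intro hf
        rwa [h01 f (mem_cellEdges.1 hf).2]
      · intro hf
        rw [h01 f (mem_cellEdges.1 hf).2, mem_cellEdges]
        exact ⟨hw.symm, by decide⟩
  · refine ⟨lam, hlam, rfl, fun i => ?_⟩
    by_contra hi
    have := le_card_of_star hcov (i := i) fun e he =>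
      mem_of_apply_nonpos hd hd0 hgen hlam (not_lt.1 hi) (mem_cellEdges.1 he).1
    omega

/-! ### Counting by degree sequences -/

open Classical in
/-- The number of members of `T` containing `k`. -/
noncomputable def degreeIn (T : Finset (Sym2 (Fin n))) (k : Fin n) : ℕ := #{e ∈ T | k ∈ e}

lemma sum_edgeVec_eq_degreeIn {T : Finset (Sym2 (Fin n))} (hT : ∀ e ∈ T, ¬ e.IsDiag) (k : Fin n) :
    ∑ e ∈ T, edgeVec e k = degreeIn T k := by
  classical
  rw [degreeIn, Finset.card_filter, Nat.cast_sum]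
  refine Finset.sum_congr rfl fun e he => ?_
  by_cases hk : k ∈ e
  · simp [edgeVec_apply_of_mem (hT e he) hk, hk]
  · simp [edgeVec_apply_of_notMem hk, hk]

lemma sum_degreeIn {T : Finset (Sym2 (Fin n))} (hT : ∀ e ∈ T, ¬ e.IsDiag) :
    ∑ k, degreeIn T k = 2 * T.card := by
  have h : ((∑ k, degreeIn T k : ℕ) : ℝ) = ((2 * T.card : ℕ) : ℝ) := by
    rw [Nat.cast_sum]
    simp only [← sum_edgeVec_eq_degreeIn hT]
    rw [Finset.sum_comm, Finset.sum_congr rfl fun e _ => sum_edgeVec e]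
    simp [mul_comm]
  exact_mod_cast h

/-- The degree sequence is the sum of the edge vectors, so complementary slackness applies with unit
weights. -/
lemma cellEdges_subset_of_degreeIn_eq {lam mu : Fin n → ℝ} (hlam : IsHeight d lam)
    (hmu : IsHeight d mu)
    (h : degreeIn (cellEdges d lam) = degreeIn (cellEdges d mu)) :
    cellEdges d mu ⊆ cellEdges d lam := by
  intro e he
  refine mem_cellEdges_of_sum_eq hlam hmu (a := fun _ => 1) (b := fun _ => 1)
    (fun _ _ => zero_le_one) (fun _ _ => zero_le_one) ?_ he one_ne_zero
  ext k
  simp only [one_smul, Finset.sum_apply]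
  rw [sum_edgeVec_eq_degreeIn fun e he => (mem_cellEdges.1 he).2,
    sum_edgeVec_eq_degreeIn fun e he => (mem_cellEdges.1 he).2, h]

lemma eq_one_of_sum_eq_card {f : Fin n → ℕ} (hf : ∀ k, 1 ≤ f k) (hs : ∑ k, f k = n) :
    f = fun _ => 1 := by
  ext k
  exact ((Finset.sum_eq_sum_iff_of_le fun k (_ : k ∈ univ) => hf k).1 (by simp [hs]) k
    (mem_univ k)).symm

lemma exists_eq_single_of_sum_eq {f : Fin n → ℕ} (hf : ∀ k, 1 ≤ f k) (hs : ∑ k, f k = n + 1) :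
    ∃ i, (fun k => 1 + (Pi.single i 1 : Fin n → ℕ) k) = f := by
  obtain ⟨i, hi⟩ : ∃ i, 2 ≤ f i := by
    by_contra! h
    have : ∑ k, f k ≤ ∑ _k : Fin n, 1 := Finset.sum_le_sum fun k _ => by have := h k; omega
    simp [hs] at this
  refine ⟨i, ?_⟩
  have hle : ∀ k ∈ univ, 1 + (Pi.single i 1 : Fin n → ℕ) k ≤ f k := by
    intro k _
    rw [Pi.single_apply]
    split_ifs with h
    · rw [h]; exact hi
    · exact hf k
  ext k
  refine (Finset.sum_eq_sum_iff_of_le hle).1 ?_ k (mem_univ k)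
  rw [hs, Finset.sum_add_distrib]
  simp

/-- Degrees are at least one and sum to `2⌈n/2⌉`, which is `n` or `n + 1`. -/
lemma encard_minimalCoverCells_le (d : Fin n → Fin n → ℝ) :
    (minimalCoverCells d).encard ≤ if Even n then 1 else (n : ℕ∞) := by
  have hinj : Set.InjOn degreeIn (minimalCoverCells d) := by
    rintro _ ⟨⟨lam, hlam, rfl⟩, -⟩ _ ⟨⟨mu, hmu, rfl⟩, -⟩ h
    exact (cellEdges_subset_of_degreeIn_eq hmu hlam h.symm).antisymm
      (cellEdges_subset_of_degreeIn_eq hlam hmu h)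
  rw [← hinj.encard_image]
  have hdeg : ∀ f ∈ degreeIn '' minimalCoverCells d,
      (∀ k, 1 ≤ f k) ∧ ∑ k, f k = 2 * ((n + 1) / 2) := by
    rintro _ ⟨_, ⟨⟨lam, hlam, rfl⟩, hcov, hcard⟩, rfl⟩
    refine ⟨fun k => ?_, ?_⟩
    · obtain ⟨e, he, hk⟩ := hcov k
      exact Finset.card_pos.2 ⟨e, mem_filter.2 ⟨he, hk⟩⟩
    · rw [sum_degreeIn fun e he => (mem_cellEdges.1 he).2, hcard]
  split_ifs with heven
  · rw [← Set.encard_singleton (fun _ : Fin n => (1 : ℕ))]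
    refine Set.encard_le_encard fun f hf => ?_
    obtain ⟨h1, h2⟩ := hdeg f hf
    exact eq_one_of_sum_eq_card h1 (by rw [h2]; obtain ⟨m, rfl⟩ := heven; omega)
  · have hsub : degreeIn '' minimalCoverCells d ⊆
        (fun i : Fin n => fun k => 1 + (Pi.single i 1 : Fin n → ℕ) k) '' Set.univ := by
      intro f hf
      obtain ⟨h1, h2⟩ := hdeg f hf
      obtain ⟨m, hm⟩ := Nat.not_even_iff_odd.1 heven
      obtain ⟨i, hi⟩ := exists_eq_single_of_sum_eq h1 (by omega)
      exact ⟨i, Set.mem_univ i, hi⟩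
    refine (Set.encard_le_encard hsub).trans ((Set.encard_image_le _ _).trans ?_)
    simp [Set.encard_univ]

/-! ### Bounded faces of `P_d` -/

lemma convex_metricPolyhedron (d : Fin n → Fin n → ℝ) : Convex ℝ (metricPolyhedron d) := by
  intro x hx y hy a b ha hb hab i j
  have h1 := mul_le_mul_of_nonneg_left (hx i j) ha
  have h2 := mul_le_mul_of_nonneg_left (hy i j) hb
  have h3 : a * d i j + b * d i j = d i j := by rw [← add_mul, hab, one_mul]
  simp only [Pi.add_apply, Pi.smul_apply, smul_eq_mul]
  linarith

lemma exists_eq_tightFace (hd : IsFiniteMetric d) {F : Set (Fin n → ℝ)}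
    (hF : IsNonemptyFace (metricPolyhedron d) F) :
    ∃ p ∈ metricPolyhedron d, F = tightFace d (tightSet d p) := by
  have hP : F ⊆ metricPolyhedron d := hF.1.subset
  have hconv : Convex ℝ F := hF.1.convex (convex_metricPolyhedron d)
  obtain ⟨l, hl⟩ := hF.1 hF.2
  -- A point of `F` with fewest tight constraints acts as a relative interior point: its midpoint
  -- with any `x` in `F` cannot have fewer, so `x` shares them all.
  obtain ⟨p, hp, hmin⟩ := (measure fun p : Fin n → ℝ => #(tightSet d p)).wf.has_min F hF.2
  refine ⟨p, hP hp, Set.Subset.antisymm (fun x hx => ⟨hP hx, fun e he => ?_⟩) fun y hy => ?_⟩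
  · have hz : (1 / 2 : ℝ) • p + (1 / 2 : ℝ) • x ∈ F :=
      hconv hp hx (by norm_num) (by norm_num) (by norm_num)
    set z := (1 / 2 : ℝ) • p + (1 / 2 : ℝ) • x with hzdef
    have hsub : ∀ f ∈ tightSet d z, f ∈ tightSet d p ∧ f ∈ tightSet d x := by
      intro f hf
      have h1 := (mem_metricPolyhedron_iff hd).1 (hP hp) f
      have h2 := (mem_metricPolyhedron_iff hd).1 (hP hx) f
      rw [mem_tightSet, hzdef, map_add, map_smul, map_smul, smul_eq_mul, smul_eq_mul] at hf
      rw [mem_tightSet, mem_tightSet]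
      constructor <;> linarith
    have heq := Finset.eq_of_subset_of_card_le (fun f hf => (hsub f hf).1) (not_lt.1 (hmin z hz))
    exact mem_tightSet.1 (hsub e (heq ▸ he)).2
  · obtain ⟨ε, hε, hmem⟩ := exists_pos_add_smul_mem hd (hP hp) (u := p - y) fun e he => by
      rw [map_sub, hy.2 e he, mem_tightSet.1 he, sub_self]
    rw [hl] at hp ⊢
    refine ⟨hy.1, fun w hw => (hp.2 w hw).trans ?_⟩
    have h1 := hp.2 _ hmem
    rw [map_add, map_smul, map_sub, smul_eq_mul] at h1
    have h2 : l p - l y ≤ 0 := nonpos_of_mul_nonpos_right (by linarith) hε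
    linarith

/-- An uncovered `k` lets coordinate `k` grow freely; a tight pair through `k` bounds it. -/
lemma isBounded_tightFace_iff (hd : IsFiniteMetric d) {p : Fin n → ℝ}
    (hp : p ∈ metricPolyhedron d) :
    Bornology.IsBounded (tightFace d (tightSet d p)) ↔ ∀ k, ∃ e ∈ tightSet d p, k ∈ e := by
  constructor
  · intro hb k
    by_contra! hk
    obtain ⟨R, hR⟩ := isBounded_iff_forall_norm_le.1 hb
    have hpos : ∀ e, pairSum e (Pi.single k (R + 1)) = edgeVec e k * (R + 1) := fun e => by
      rw [pairSum_eq_dotProduct, dotProduct_single]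
    have hR0 : 0 ≤ R := (norm_nonneg p).trans (hR p (mem_tightFace_tightSet hp))
    have hmem : p + Pi.single k (R + 1) ∈ tightFace d (tightSet d p) := by
      refine ⟨(mem_metricPolyhedron_iff hd).2 fun e => ?_, fun e he => ?_⟩
      · rw [map_add, hpos]
        have := (mem_metricPolyhedron_iff hd).1 hp e
        have := mul_nonneg (edgeVec_nonneg e k) (by linarith : 0 ≤ R + 1)
        linarith
      · rw [map_add, hpos, edgeVec_apply_of_notMem (hk e he), zero_mul, add_zero,
          mem_tightSet.1 he]
    have h1 := (norm_le_pi_norm (p + Pi.single k (R + 1)) k).trans (hR _ hmem)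
    rw [Pi.add_apply, Pi.single_eq_same, Real.norm_eq_abs] at h1
    have h2 := nonneg_of_mem_metricPolyhedron hd hp k
    linarith [le_abs_self (p k + (R + 1))]
  · intro hcov
    obtain ⟨C, hC, h⟩ := exists_forall_weight_lt hd
    refine (Metric.isBounded_Icc (0 : Fin n → ℝ) (fun _ => C)).subset fun x hx => ?_
    have hx0 := nonneg_of_mem_metricPolyhedron hd hx.1
    refine ⟨hx0, fun k => ?_⟩
    obtain ⟨e, he, hk⟩ := hcov k
    obtain ⟨j, rfl⟩ := Sym2.mem_iff_exists.1 hk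
    have h1 := hx.2 _ he
    rw [weight_mk hd, pairSum_mk] at h1
    change x k ≤ C
    linarith [h k j, hx0 j]

lemma setOf_tightSpan_affDim_eq (hd : IsFiniteMetric d) (hd0 : d ≠ 0) (hgen : IsGenericMetric d)
    (hn : 2 ≤ n) :
    {F ∈ tightSpan d | affDim F = n / 2} = tightFace d '' minimalCoverTightSets d := by
  ext F
  constructor
  · rintro ⟨⟨hF, hb⟩, hdim⟩
    obtain ⟨p, hp, rfl⟩ := exists_eq_tightFace hd hF
    have hcov := (isBounded_tightFace_iff hd hp).1 hb
    have hcard := affDim_tightFace hd hp (linearIndepOn_tightSet hd hd0 hgen hp)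
    rw [hdim] at hcard
    refine ⟨_, ⟨⟨p, hp, rfl⟩, fun e he hed => ?_, hcov, by omega⟩, rfl⟩
    induction e with | _ i j =>
    obtain rfl : i = j := by simpa using hed
    have hi : p i ≤ 0 := by
      have := mem_tightSet.1 he
      rw [pairSum_mk, weight_mk hd, hd.diag] at this
      linarith
    -- A tight loop would make the tight set a full star with `n` members, more than `⌈n/2⌉`.
    have := le_card_of_star_of_loop hcov (fun f hf => mem_of_apply_nonpos hd hd0 hgen
      (isHeight_of_mem_metricPolyhedron hd hp) hi (mem_tightSet.1 hf)) he
    omega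
  · rintro ⟨_, ⟨⟨p, hp, rfl⟩, -, hcov, hcard⟩, rfl⟩
    have hdim := affDim_tightFace hd hp (linearIndepOn_tightSet hd hd0 hgen hp)
    exact ⟨⟨isNonemptyFace_tightFace hd (mem_tightFace_tightSet hp),
      (isBounded_tightFace_iff hd hp).2 hcov⟩, by omega⟩

lemma faceCount_tightSpan (hd : IsFiniteMetric d) (hd0 : d ≠ 0) (hgen : IsGenericMetric d)
    (hn : 2 ≤ n) : faceCount (tightSpan d) (n / 2) = (minimalCoverTightSets d).encard := by
  have hinj : Set.InjOn (tightFace d) (minimalCoverTightSets d) := by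
    have key : ∀ {x y : Fin n → ℝ}, x ∈ metricPolyhedron d →
        tightFace d (tightSet d x) = tightFace d (tightSet d y) → tightSet d y ⊆ tightSet d x := by
      intro x y hx h e he
      have h1 := mem_tightFace_tightSet hx
      rw [h] at h1
      exact mem_tightSet.2 (h1.2 e he)
    rintro _ ⟨⟨x, hx, rfl⟩, -⟩ _ ⟨⟨y, hy, rfl⟩, -⟩ h
    exact (key hy h.symm).antisymm (key hx h)
  rw [faceCount, setOf_tightSpan_affDim_eq hd hd0 hgen hn, hinj.encard_image]

/-! ### Counting interior cells -/

lemma setOf_interiorFaces_card_eq_subset (hd : IsFiniteMetric d) (hn : 2 ≤ n) :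
    {s ∈ interiorFaces (hypersimplexSubdivision d) (secondHypersimplex n) |
      s.card = (n + 1) / 2 - 1 + 1} ⊆ cellVertices '' minimalCoverCells d := by
  rintro s ⟨hs, hcard⟩
  obtain ⟨-, lam, hlam, rfl⟩ := (mem_hypersimplexSubdivision_iff hd).1 hs.1
  rw [cellVertices, card_map] at hcard
  exact ⟨_, ⟨⟨lam, hlam, rfl⟩, forall_exists_mem_of_mem_interiorFaces hn hs, by omega⟩, rfl⟩

/-- Only a star could be a boundary cell here, and it has too many edges for `n ≥ 4`. For `n = 3`
two-edge stars do lie in the boundary. -/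
lemma subset_setOf_interiorFaces_card_eq (hd : IsFiniteMetric d) (hd0 : d ≠ 0)
    (hgen : IsGenericMetric d) (hn : 2 ≤ n) (hn3 : n ≠ 3) :
    cellVertices '' minimalCoverCells d ⊆
      {s ∈ interiorFaces (hypersimplexSubdivision d) (secondHypersimplex n) |
        s.card = (n + 1) / 2 - 1 + 1} := by
  rintro _ ⟨_, ⟨⟨lam, hlam, rfl⟩, hcov, hcard⟩, rfl⟩
  have hne : (cellEdges d lam).Nonempty := card_pos.1 (by omega)
  have hne' : (cellVertices (cellEdges d lam)).Nonempty := hne.map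
  refine ⟨⟨(mem_hypersimplexSubdivision_iff hd).2 ⟨hne', lam, hlam, rfl⟩, ?_⟩, ?_⟩
  · rcases eq_or_ne n 2 with rfl | hn2
    · rw [intrinsicFrontier_secondHypersimplex_two hd hd0 hgen, Set.subset_empty_iff,
        convexHull_eq_empty, Finset.coe_eq_empty]
      exact hne'.ne_empty
    · refine not_subset_intrinsicFrontier hd hd0 hgen hne hcov fun k => ?_
      by_contra! hk
      have := le_card_of_star hcov hk
      omega
  · rw [cellVertices, card_map]
    omega

theorem isAlmostSmallFaceFree_hypersimplexSubdivision (hd : IsFiniteMetric d) (hn : 2 ≤ n) :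
    IsAlmostSmallFaceFree (n - 1) (hypersimplexSubdivision d) (secondHypersimplex n) := by
  intro k hk s hs hcard
  obtain ⟨-, lam, hlam, rfl⟩ := (mem_hypersimplexSubdivision_iff hd).1 hs.1
  have := le_two_mul_card_of_cover (forall_exists_mem_of_mem_interiorFaces hn hs)
  rw [cellVertices, card_map] at hcard
  omega

theorem mainTheorem4 (n : ℕ) (hn : 2 ≤ n) (d : Fin n → Fin n → ℝ) (hd : IsFiniteMetric d)
    (hd0 : d ≠ 0) (hgen : IsGenericMetric d) :
    IsTriangulationOf (hypersimplexSubdivision d) (secondHypersimplex n) ∧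
    IsAlmostSmallFaceFree (n - 1) (hypersimplexSubdivision d) (secondHypersimplex n) ∧
    (n ≠ 3 →
      faceCount (tightSpan d) (n / 2) =
        simplexCount (interiorFaces (hypersimplexSubdivision d) (secondHypersimplex n))
          ((n + 1) / 2 - 1)) ∧
    faceCount (tightSpan d) (n / 2) ≤ (if Even n then 1 else (n : ℕ∞)) ∧
    simplexCount (interiorFaces (hypersimplexSubdivision d) (secondHypersimplex n))
        ((n + 1) / 2 - 1) ≤ (if Even n then 1 else (n : ℕ∞)) := by
  have hinj : (cellVertices '' minimalCoverCells d).encard = (minimalCoverCells d).encard :=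
    cellVertices_injective.injOn.encard_image
  refine ⟨isTriangulationOf_hypersimplexSubdivision hd hd0 hgen,
    isAlmostSmallFaceFree_hypersimplexSubdivision hd hn, fun hn3 => ?_, ?_, ?_⟩
  · rw [faceCount_tightSpan hd hd0 hgen hn, simplexCount,
      (setOf_interiorFaces_card_eq_subset hd hn).antisymm
        (subset_setOf_interiorFaces_card_eq hd hd0 hgen hn hn3), hinj,
      (minimalCoverTightSets_subset hd).antisymm (minimalCoverCells_subset hd hd0 hgen hn hn3)]
  -- The bounds need only the inclusions that remain valid for `n = 3`.
  · rw [faceCount_tightSpan hd hd0 hgen hn]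
    exact (Set.encard_le_encard (minimalCoverTightSets_subset hd)).trans
      (encard_minimalCoverCells_le d)
  · refine (Set.encard_le_encard (setOf_interiorFaces_card_eq_subset hd hn)).trans ?_
    rw [hinj]
    exact encard_minimalCoverCells_le d
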